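/- Let $A\in\mathbb R^{L\times M}$ have full rank $r=\min\{M,L\}\ge 1$, let $\sigma>0$, let $\mathbf X\sim\mathcal N(0,I_M)$ and $\mathbf Z\sim\mathcal N(0,\sigma^2I_L)$ be independent, and let $\mathbf Y=A\mathbf X+\mathbf Z$. For $R\ge 0$ let $$D_{X|Y}(R)=\inf\ \frac1M\,\mathbb E\,\|\mathbf X-\widehat{\mathbf X}\|^2,$$ where the infimum is over all joint distributions of $\mathbf Y$ and an $\mathbb R^M$-valued $\widehat{\mathbf X}$ (with $\mathbf X\to\mathbf Y\to\widehat{\mathbf X}$ a Markov chain and $\mathbf Y$ having its given law) such that $I(\mathbf Y;\widehat{\mathbf X})\le R$ (in bits). Write $\lambda_l(C)$ for the $l$-th largest eigenvalue of a symmetric matrix $C$. For $C$ positive semidefinite and $1\le k\le \mathrm{rank}(C)$ put $$\theta_k(C,R)=2^{-2R/k}\Big(\prod_{l=1}^k\lambda_l(C)\Big)^{1/k},$$ and let $R_1(C)=0$, $R_k(C)=\frac12\sum_{l=1}^k\log_2\frac{\lambda_l(C)}{\lambda_k(C)}$ for $2\le k\le\mathrm{rank}(C)$, and $R_{\mathrm{rank}(C)+1}(C)=\infty$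 (for $\mathrm{rank}(C)\geq 1$). Let $\lambda_l=\lambda_l(AA^T)$ and $\Sigma_{X|Y}=A^T(AA^T+\sigma^2I_L)^{-1}A$. If $k\in\{1,\dots,r\}$ and $R$ is a real number with $$R_k(\Sigma_{X|Y})<R\le R_{k+1}(\Sigma_{X|Y}),$$ then $$D_{X|Y}(R)=1-\frac1M\sum_{l=1}^k\frac{\lambda_l}{\lambda_l+\sigma^2}+\frac kM\,\theta_k(\Sigma_{X|Y},R),$$ and this is also the value of the estimate-and-compress expression $$\frac1M\Big(\mathbb E\,\|\mathbf X-\mathbb E[\mathbf X|\mathbf Y]\|^2+\min_{\widehat{\mathbf X}:\,I(\mathbf Y;\widehat{\mathbf X})\le R}\mathbb E\,\big\|\mathbb E[\mathbf X|\mathbf Y]-\widehat{\mathbf X}\big\|^2\Big),$$ in which the minimum is over the same joint distributions and is attained. -/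

import Mathlib

open MeasureTheory ProbabilityTheory
open scoped ENNReal Matrix

namespace RemoteSource

/-- The `l`-th largest eigenvalue (`l = 1, …, n`, counted with multiplicity) of a real square
matrix with real spectrum: the `l`-th entry of the decreasingly sorted list of roots of its
characteristic polynomial. -/
noncomputable def eigval {n : ℕ} (C : Matrix (Fin n) (Fin n) ℝ) (l : ℕ) : ℝ :=
  (C.charpoly.roots.sort (· ≥ ·)).getD (l - 1) 0

/-- The rate threshold `R_k(C)` (in bits) for `1 ≤ k ≤ rank C + 1`; it is `∞` at
`k = rank C + 1`. -/
noncomputable def rateThreshold {n : ℕ} (C : Matrix (Fin n) (Fin n) ℝ) (k : ℕ) : EReal :=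
  if k = 1 then 0
  else if k ≤ C.rank then
    (((1 / 2 : ℝ) * ∑ l ∈ Finset.Icc 1 k, Real.logb 2 (eigval C l / eigval C k) : ℝ) : EReal)
  else ⊤

/-- The water level `θ_k(C, R)`. -/
noncomputable def waterLevel {n : ℕ} (C : Matrix (Fin n) (Fin n) ℝ) (k : ℕ) (R : ℝ) : ℝ :=
  (2 : ℝ) ^ (-(2 * R / (k : ℝ))) * (∏ l ∈ Finset.Icc 1 k, eigval C l) ^ (1 / (k : ℝ))

variable {M L : ℕ}

/-- `Σ_{X|Y} = Aᵀ (A Aᵀ + σ² I)⁻¹ A`, the covariance matrix of the estimate of `X` from `Y`. -/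
noncomputable def estimateCov (A : Matrix (Fin L) (Fin M) ℝ) (σ : ℝ) :
    Matrix (Fin M) (Fin M) ℝ :=
  Aᵀ * (A * Aᵀ + σ ^ 2 • (1 : Matrix (Fin L) (Fin L) ℝ))⁻¹ * A

/-- The joint law of `(X, Y)`, where `Y = A X + Z`, `X ∼ N(0, I_M)`, `Z ∼ N(0, σ² I_L)`, and
`X` and `Z` are independent. -/
noncomputable def modelLaw (A : Matrix (Fin L) (Fin M) ℝ) (σ : ℝ) :
    Measure (EuclideanSpace ℝ (Fin M) × EuclideanSpace ℝ (Fin L)) :=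
  ((multivariateGaussian (0 : EuclideanSpace ℝ (Fin M)) (1 : Matrix (Fin M) (Fin M) ℝ)).prod
    (multivariateGaussian (0 : EuclideanSpace ℝ (Fin L))
      (σ ^ 2 • (1 : Matrix (Fin L) (Fin L) ℝ)))).map
    (fun p => (p.1, Matrix.toEuclideanLin A p.1 + p.2))

/-- The law of the observation `Y`. -/
noncomputable def obsLaw (A : Matrix (Fin L) (Fin M) ℝ) (σ : ℝ) :
    Measure (EuclideanSpace ℝ (Fin L)) :=
  (modelLaw A σ).snd

/-- The mutual information, in bits, of a pair of random variables with joint law `μ`. -/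
noncomputable def mutualInfo {α β : Type*} [MeasurableSpace α] [MeasurableSpace β]
    (μ : Measure (α × β)) : ℝ≥0∞ :=
  InformationTheory.klDiv μ (μ.fst.prod μ.snd) / ENNReal.ofReal (Real.log 2)

/-- The channels `Y → X̂` with `I(Y; X̂) ≤ R`. Together with the law of `Y`, they describe all
joint laws of `(Y, X̂)` that satisfy the rate constraint. -/
def feasible (A : Matrix (Fin L) (Fin M) ℝ) (σ R : ℝ) :
    Set (Kernel (EuclideanSpace ℝ (Fin L)) (EuclideanSpace ℝ (Fin M))) :=
  {κ | IsMarkovKernel κ ∧ mutualInfo (obsLaw A σ ⊗ₘ κ) ≤ ENNReal.ofReal R}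

/-- The joint law of `((X, Y), X̂)` when `X̂` is drawn from `Y` through the channel `κ`, so that
`X`, `Y`, `X̂` is a Markov chain. -/
noncomputable def jointLaw (A : Matrix (Fin L) (Fin M) ℝ) (σ : ℝ)
    (κ : Kernel (EuclideanSpace ℝ (Fin L)) (EuclideanSpace ℝ (Fin M))) :
    Measure ((EuclideanSpace ℝ (Fin M) × EuclideanSpace ℝ (Fin L)) × EuclideanSpace ℝ (Fin M)) :=
  modelLaw A σ ⊗ₘ Kernel.prodMkLeft (EuclideanSpace ℝ (Fin M)) κ

/-- The normalized quadratic distortion `(1 / M) E ‖X - X̂‖²`. -/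
noncomputable def distortion (A : Matrix (Fin L) (Fin M) ℝ) (σ : ℝ)
    (κ : Kernel (EuclideanSpace ℝ (Fin L)) (EuclideanSpace ℝ (Fin M))) : ℝ≥0∞ :=
  (∫⁻ p, ‖p.1.1 - p.2‖ₑ ^ 2 ∂(jointLaw A σ κ)) / (M : ℝ≥0∞)

/-- The indirect distortion-rate function: the infimum of the distortion between `X` and `X̂` over
all joint laws of `Y` and `X̂` with `I(Y; X̂) ≤ R`. -/
noncomputable def iDRF (A : Matrix (Fin L) (Fin M) ℝ) (σ R : ℝ) : ℝ≥0∞ :=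
  sInf (distortion A σ '' feasible A σ R)

/-- The conditional expectation `E[X | Y]`, as a random variable on the space of pairs `(x, y)`. -/
noncomputable def condMean (A : Matrix (Fin L) (Fin M) ℝ) (σ : ℝ) :
    EuclideanSpace ℝ (Fin M) × EuclideanSpace ℝ (Fin L) → EuclideanSpace ℝ (Fin M) :=
  (modelLaw A σ)[Prod.fst | MeasurableSpace.comap Prod.snd inferInstance]

/-- The minimum mean square error `E ‖X - E[X | Y]‖²`, that is, the trace of the error covariance
matrix. -/
noncomputable def mmse (A : Matrix (Fin L) (Fin M) ℝ) (σ : ℝ) : ℝ≥0∞ :=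
  ∫⁻ p, ‖p.1 - condMean A σ p‖ₑ ^ 2 ∂(modelLaw A σ)

/-- The error `E ‖E[X | Y] - X̂‖²` in compressing the estimate of `X` through the channel `κ`. -/
noncomputable def estimateDistortion (A : Matrix (Fin L) (Fin M) ℝ) (σ : ℝ)
    (κ : Kernel (EuclideanSpace ℝ (Fin L)) (EuclideanSpace ℝ (Fin M))) : ℝ≥0∞ :=
  ∫⁻ p, ‖condMean A σ p.1 - p.2‖ₑ ^ 2 ∂(jointLaw A σ κ)

end RemoteSource

/-! Put K = AAᵀ + σ²I and B = AᵀK⁻¹. Since X and Y are jointly Gaussian and BK = Aᵀ, the error X -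
BY is uncorrelated with Y, hence independent of it. So BY is the conditional mean, and for every
channel the distortion is the mean square error plus the error in reproducing BY (`indepFun_error`,
`lintegral_jointLaw`). Both expressions in the theorem thus reduce to compressing the Gaussian
vector BY, whose covariance is `estimateCov A σ`; in an eigenbasis its coordinates are independent
with the eigenvalues aᵢ as variances (`map_repr_estimate`).

What remains is reverse water-filling at level θ: coordinates with aᵢ > θ get distortion θ, the
others are reproduced by 0 and keep distortion aᵢ. Both halves rest on one function, `tilt`, the
log-density of the Gaussian test channel. For achievability (`exists_channel`), the exponential of
the summed tilts is a density that normalises in both variables, so the divergence is its mean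
logarithm. For the converse (`le_lintegral_of_klDiv_le`), the same kind of sum is a test function in
the Donsker–Varadhan bound; its mean involves only second moments, so any joint law can be handled
without densities or differential entropies.

Finally, the eigenvalues of the covariance are λ/(λ + σ²) (`eigval_estimateCov`), the condition on R
says exactly that θ lies below the k-th eigenvalue and not below the next one, and the trace
identity `mmse_add_sum_eigenvalues` gives the closed form. -/

namespace RemoteSource

/-! ### Variational lower bound on relative entropy -/

/-- Young's inequality for the pair `klFun`, `exp`. -/
lemma mul_le_klFun_add_exp {g : ℝ} (hg : 0 ≤ g) (f : ℝ) :
    g * f ≤ InformationTheory.klFun g + Real.exp f - 1 := by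
  rw [InformationTheory.klFun_apply]
  rcases hg.eq_or_lt with rfl | hg
  · simpa using (Real.exp_pos f).le
  · have h := Real.add_one_le_exp (f - Real.log g)
    rw [Real.exp_sub, Real.exp_log hg, le_div_iff₀ hg] at h
    nlinarith

/-- The Donsker–Varadhan lower bound on the Kullback–Leibler divergence. -/
lemma integral_le_toReal_klDiv {α : Type*} [MeasurableSpace α] {μ ν : Measure α}
    [IsProbabilityMeasure μ] [IsProbabilityMeasure ν] {f : α → ℝ} (hf : Integrable f μ)
    (hfm : Measurable f) (hexp : ∫⁻ a, ENNReal.ofReal (Real.exp (f a)) ∂ν ≤ 1)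
    (hkl : InformationTheory.klDiv μ ν ≠ ∞) :
    ∫ a, f a ∂μ ≤ (InformationTheory.klDiv μ ν).toReal := by
  obtain ⟨hac, hllr⟩ := InformationTheory.klDiv_ne_top_iff.1 hkl
  have hei : Integrable (fun a => Real.exp (f a)) ν := by
    rw [← lintegral_ofReal_ne_top_iff_integrable (by fun_prop)
      (ae_of_all _ fun a => (Real.exp_pos _).le)]
    exact (hexp.trans_lt ENNReal.one_lt_top).ne
  have he : ∫ a, Real.exp (f a) ∂ν ≤ 1 := by
    rw [integral_eq_lintegral_of_nonneg_ae (ae_of_all _ fun a => (Real.exp_pos _).le)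
      (by fun_prop)]
    exact ENNReal.toReal_le_of_le_ofReal zero_le_one (by simpa using hexp)
  have hkf := (InformationTheory.integrable_klFun_rnDeriv_iff hac).2 hllr
  have hgf : Integrable (fun a => (μ.rnDeriv ν a).toReal * f a) ν := by
    simpa [smul_eq_mul] using (integrable_rnDeriv_smul_iff hac).2 hf
  rw [InformationTheory.toReal_klDiv_eq_integral_klFun hac]
  calc ∫ a, f a ∂μ = ∫ a, (μ.rnDeriv ν a).toReal * f a ∂ν := by
        rw [← integral_rnDeriv_smul hac]; rfl
    _ ≤ ∫ a, (InformationTheory.klFun (μ.rnDeriv ν a).toReal + Real.exp (f a) - 1) ∂ν :=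
        integral_mono hgf ((hkf.add hei).sub (integrable_const _))
          fun a => mul_le_klFun_add_exp ENNReal.toReal_nonneg _
    _ = ∫ a, InformationTheory.klFun (μ.rnDeriv ν a).toReal ∂ν + ∫ a, Real.exp (f a) ∂ν - 1 := by
        rw [integral_sub (f := fun a => InformationTheory.klFun (μ.rnDeriv ν a).toReal +
          Real.exp (f a)) (hkf.add hei) (integrable_const _), integral_add hkf hei]
        simp
    _ ≤ _ := by linarith

/-! ### The Gaussian test channel in one coordinate -/

/-- The logarithm of the density of the Gaussian test channel of a coordinate, at distortion `θ`
and variance `a`. -/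
noncomputable def tilt (a θ e x : ℝ) : ℝ :=
  1 / 2 * Real.log (a / θ) + e ^ 2 / (2 * a) - (e - x) ^ 2 / (2 * θ)

lemma measurable_tilt (a θ : ℝ) : Measurable (fun p : ℝ × ℝ => tilt a θ p.1 p.2) := by
  unfold tilt; fun_prop

/-- The backward channel: `exp tilt` is the ratio of the N(x, θ) and N(0, a) densities, whatever the
order of a and θ. -/
lemma withDensity_tilt_source {a θ : NNReal} (ha : a ≠ 0) (hθ : θ ≠ 0) (x : ℝ) :
    (gaussianReal 0 a).withDensity (fun e => ENNReal.ofReal (Real.exp (tilt a θ e x))) =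
      gaussianReal x θ := by
  have ha' : (0 : ℝ) < a := by positivity
  have hθ' : (0 : ℝ) < θ := by positivity
  rw [gaussianReal_of_var_ne_zero _ ha, gaussianReal_of_var_ne_zero _ hθ,
    ← withDensity_mul _ (by fun_prop) (by unfold tilt; fun_prop)]
  congr 1
  ext e
  rw [Pi.mul_apply, gaussianPDF, gaussianPDF, ← ENNReal.ofReal_mul (gaussianPDFReal_nonneg _ _ _)]
  congr 1
  rw [gaussianPDFReal, gaussianPDFReal, tilt, Real.exp_sub, Real.exp_add, mul_comm (1 / 2 : ℝ),
    ← Real.rpow_def_of_pos (by positivity), ← Real.sqrt_eq_rpow, Real.sqrt_div ha'.le,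
    sub_zero, neg_div, neg_div,
    Real.exp_neg, Real.exp_neg]
  rw [Real.sqrt_mul (x := 2 * Real.pi) (by positivity),
    Real.sqrt_mul (x := 2 * Real.pi) (by positivity)]
  have := (Real.sqrt_pos.2 ha').ne'
  have := (Real.sqrt_pos.2 hθ').ne'
  field_simp

/-- The forward channel, by completing the square in x. Later only its total mass, one, is needed.
-/
lemma withDensity_tilt_reproduction {a θ : NNReal} (hθ : θ ≠ 0) (h : θ < a) (e : ℝ) :
    (gaussianReal 0 (a - θ)).withDensity (fun x => ENNReal.ofReal (Real.exp (tilt a θ e x))) =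
      gaussianReal ((1 - θ / a) * e) (θ * (a - θ) / a) := by
  have hθ' : (0 : ℝ) < θ := by positivity
  have hb : 0 < a - θ := tsub_pos_of_lt h
  have ha : 0 < a := hθ.bot_lt.trans h
  obtain ⟨b, rfl⟩ : ∃ b, a = θ + b := ⟨a - θ, (add_tsub_cancel_of_le h.le).symm⟩
  rw [add_tsub_cancel_left] at *
  have hb' : (0 : ℝ) < b := by exact_mod_cast hb
  rw [gaussianReal_of_var_ne_zero _ hb.ne', gaussianReal_of_var_ne_zero _ (by positivity),
    ← withDensity_mul _ (by fun_prop) (by unfold tilt; fun_prop)]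
  congr 1
  ext x
  rw [Pi.mul_apply, gaussianPDF, gaussianPDF, ← ENNReal.ofReal_mul (gaussianPDFReal_nonneg _ _ _)]
  congr 1
  rw [gaussianPDFReal, gaussianPDFReal, tilt, Real.exp_sub, Real.exp_add, mul_comm (1 / 2 : ℝ),
    ← Real.rpow_def_of_pos (by push_cast; positivity), ← Real.sqrt_eq_rpow]
  push_cast
  have h1 : (Real.sqrt (2 * Real.pi * b))⁻¹ * Real.sqrt ((θ + b) / θ) =
      (Real.sqrt (2 * Real.pi * (θ * b / (θ + b))))⁻¹ := by
    rw [← Real.sqrt_inv, ← Real.sqrt_inv, ← Real.sqrt_mul (by positivity)]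
    congr 1
    field_simp
  rw [← h1, mul_div_assoc, ← Real.exp_sub, mul_mul_mul_comm, ← Real.exp_add]
  congr 2
  field_simp
  ring

/-- Below the water level the variance parameter is replaced by θ. The exponent becomes xe/θ -
x²/(2θ), and the Gaussian moment generating function yields exp(ax²/(2θ²) - x²/(2θ)), at most 1
because a ≤ θ. -/
lemma lintegral_tilt_le_one {a θ : NNReal} (hθ : θ ≠ 0) (h : a ≤ θ) (x : ℝ) :
    ∫⁻ e, ENNReal.ofReal (Real.exp (tilt θ θ e x)) ∂(gaussianReal 0 a) ≤ 1 := by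
  have hθ' : (0 : ℝ) < θ := by positivity
  have h1 (e : ℝ) : Real.exp (tilt θ θ e x) =
      Real.exp (-(x ^ 2 / (2 * θ))) * Real.exp (x / θ * e) := by
    rw [tilt, div_self hθ'.ne', ← Real.exp_add]
    congr 1
    simp
    field_simp
    ring
  simp_rw [h1]
  rw [← ofReal_integral_eq_lintegral_ofReal ((integrable_exp_mul_gaussianReal _).const_mul _)
    (ae_of_all _ fun _ => by positivity), integral_const_mul]
  have h2 := congrFun (mgf_fun_id_gaussianReal (μ := 0) (v := a)) (x / θ)
  rw [mgf] at h2
  rw [h2, ← Real.exp_add, ENNReal.ofReal_le_one, Real.exp_le_one_iff]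
  have h3 : (a : ℝ) ≤ θ := h
  have h4 : (a : ℝ) * (x / θ) ^ 2 / 2 ≤ θ * (x / θ) ^ 2 / 2 := by gcongr
  have h5 : (θ : ℝ) * (x / θ) ^ 2 / 2 = x ^ 2 / (2 * θ) := by field_simp
  linarith

lemma lintegral_pi_prod {ι : Type*} [Fintype ι] {E : ι → Type*} [∀ i, MeasurableSpace (E i)]
    (μ : (i : ι) → Measure (E i)) [∀ i, IsProbabilityMeasure (μ i)]
    {f : (i : ι) → E i → ℝ≥0∞} (hf : ∀ i, Measurable (f i)) :
    ∫⁻ x, ∏ i, f i (x i) ∂(Measure.pi μ) = ∏ i, ∫⁻ x, f i x ∂(μ i) := by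
  have hind : iIndepFun (fun i (x : (i : ι) → E i) => f i (x i)) (Measure.pi μ) :=
    iIndepFun_pi (fun i => (hf i).aemeasurable)
  rw [lintegral_prod_eq_prod_lintegral_of_indepFun Finset.univ _ hind
    (fun i => (hf i).comp (measurable_pi_apply i))]
  refine Finset.prod_congr rfl fun i _ => ?_
  exact (measurePreserving_eval μ i).lintegral_comp (hf i)

lemma lintegral_sub_sq_gaussianReal (x : ℝ) (v : NNReal) :
    ∫⁻ e, ENNReal.ofReal ((e - x) ^ 2) ∂(gaussianReal x v) = v := by
  have h := variance_fun_id_gaussianReal (μ := x) (v := v)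
  have h2 : evariance (fun e => e) (gaussianReal x v) =
      ∫⁻ e, ENNReal.ofReal ((e - x) ^ 2) ∂(gaussianReal x v) := by
    rw [evariance_eq_lintegral_ofReal]
    simp
  rw [← h2, ← MemLp.ofReal_variance_eq (X := fun e : ℝ => e) (memLp_id_gaussianReal 2), h]
  simp


section Weights

variable {ι : Type*} [DecidableEq ι] {a : ι → NNReal} {θ : NNReal} {S : Finset ι}

lemma measurable_ite_tilt_left (i : ι) (z : ℝ) : Measurable fun w =>
    (if i ∈ S then ENNReal.ofReal (Real.exp (tilt (a i) θ w z)) else 1) := by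
  split_ifs
  · unfold tilt; fun_prop
  · fun_prop

lemma measurable_ite_tilt_right (i : ι) (w : ℝ) : Measurable fun z =>
    (if i ∈ S then ENNReal.ofReal (Real.exp (tilt (a i) θ w z)) else 1) := by
  split_ifs
  · unfold tilt; fun_prop
  · fun_prop

lemma lintegral_tilt_source (hθ : θ ≠ 0) (hS : ∀ i ∈ S, θ < a i) (i : ι) (z : ℝ) :
    ∫⁻ w, (if i ∈ S then ENNReal.ofReal (Real.exp (tilt (a i) θ w z)) else 1)
      ∂(gaussianReal 0 (a i)) = 1 := by
  split_ifs with hi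
  · have h := congrArg (fun ν => ν Set.univ) (withDensity_tilt_source
      (hθ.bot_lt.trans (hS i hi)).ne' hθ z)
    simpa only [withDensity_apply _ MeasurableSet.univ, Measure.restrict_univ,
      measure_univ] using h
  · simp

end Weights

/-! ### Reverse water-filling for independent Gaussian coordinates -/

section Coordinates

variable {Ω ι E : Type*} [MeasurableSpace Ω] [Fintype ι]
  [NormedAddCommGroup E] [InnerProductSpace ℝ E]
  {P : Measure Ω} {T : Ω → E} {b : OrthonormalBasis ι ℝ E}
  {a : ι → NNReal} {θ r : NNReal} {S : Finset ι}

lemma enorm_sub_sq (b : OrthonormalBasis ι ℝ E) (x y : E) :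
    ‖x - y‖ₑ ^ 2 = ∑ i, ENNReal.ofReal ((b.repr x i - b.repr y i) ^ 2) := by
  rw [← ENNReal.ofReal_sum_of_nonneg fun _ _ => sq_nonneg _, ← ofReal_norm,
    ← ENNReal.ofReal_pow (norm_nonneg _), ← b.repr.norm_map, EuclideanSpace.real_norm_sq_eq]
  simp

lemma ofReal_exp_sum {κ : Type*} {f : κ → ℝ} (s : Finset κ) :
    ENNReal.ofReal (Real.exp (∑ i ∈ s, f i)) = ∏ i ∈ s, ENNReal.ofReal (Real.exp (f i)) := by
  rw [Real.exp_sum, ENNReal.ofReal_prod_of_nonneg fun _ _ => (Real.exp_pos _).le]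

/-- Being quadratic, the tilt has a mean determined by two second moments, for an arbitrary joint
law. -/
lemma integrable_tilt_and_integral_eq {α : Type*} [MeasurableSpace α] {μ : Measure α}
    [IsProbabilityMeasure μ] {u x : α → ℝ} (hu : Integrable (fun p => u p ^ 2) μ)
    (hd : Integrable (fun p => (u p - x p) ^ 2) μ) (a θ : ℝ) :
    Integrable (fun p => tilt a θ (u p) (x p)) μ ∧
      ∫ p, tilt a θ (u p) (x p) ∂μ = 1 / 2 * Real.log (a / θ) + (∫ p, u p ^ 2 ∂μ) / (2 * a)
        - (∫ p, (u p - x p) ^ 2 ∂μ) / (2 * θ) := by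
  have h1 : Integrable (fun p => 1 / 2 * Real.log (a / θ) + u p ^ 2 / (2 * a)) μ :=
    (integrable_const _).add (hu.div_const _)
  refine ⟨h1.sub (hd.div_const _), ?_⟩
  simp only [tilt]
  rw [integral_sub h1 (hd.div_const _), integral_add (integrable_const _) (hu.div_const _),
    integral_div, integral_div]
  simp

/-- The density of the test channel with respect to the law of its reproduction. -/
noncomputable def channelDensity {Ω : Type*} (b : OrthonormalBasis ι ℝ E) (T : Ω → E)
    (a : ι → NNReal) (θ : NNReal) (S : Finset ι) (y : Ω) (x : E) : ℝ :=
  ∑ i ∈ S, tilt (a i) θ (b.repr (T y) i) (b.repr x i)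

lemma ofReal_exp_channelDensity {Ω : Type*} [DecidableEq ι] {T : Ω → E} (y : Ω) (x : E) :
    ENNReal.ofReal (Real.exp (channelDensity b T a θ S y x)) =
      ∏ i, if i ∈ S then
        ENNReal.ofReal (Real.exp (tilt (a i) θ (b.repr (T y) i) (b.repr x i))) else 1 := by
  rw [channelDensity, ofReal_exp_sum, Finset.prod_ite_mem, Finset.univ_inter]

variable [MeasurableSpace E] [BorelSpace E]

lemma measurable_repr (b : OrthonormalBasis ι ℝ E) (i : ι) : Measurable (fun x => b.repr x i) := by
  have : Continuous (fun x => b.repr x i) := by fun_prop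
  exact this.measurable

lemma measurable_repr_comp (b : OrthonormalBasis ι ℝ E) (hT : Measurable T) (i : ι) :
    Measurable (fun y => b.repr (T y) i) :=
  (measurable_repr b i).comp hT

/-- Integrating a product of functions of the independent coordinates. -/
lemma lintegral_prod_repr (hT : Measurable T)
    (hlaw : P.map (fun y i => b.repr (T y) i) = Measure.pi fun i => gaussianReal 0 (a i))
    {f : ι → ℝ → ℝ≥0∞} (hf : ∀ i, Measurable (f i)) :
    ∫⁻ y, ∏ i, f i (b.repr (T y) i) ∂P = ∏ i, ∫⁻ u, f i u ∂(gaussianReal 0 (a i)) := by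
  rw [← lintegral_pi_prod _ hf, ← hlaw, lintegral_map (by fun_prop)]
  exact measurable_pi_lambda _ fun i => measurable_repr_comp b hT i

lemma map_repr_eq_gaussianReal (hT : Measurable T)
    (hlaw : P.map (fun y i => b.repr (T y) i) = Measure.pi fun i => gaussianReal 0 (a i)) (i : ι) :
    P.map (fun y => b.repr (T y) i) = gaussianReal 0 (a i) := by
  have h : (fun y => b.repr (T y) i) = (fun u : ι → ℝ => u i) ∘ fun y i => b.repr (T y) i := rfl
  rw [h, ← Measure.map_map (by fun_prop)
    (measurable_pi_lambda _ fun i => measurable_repr_comp b hT i), hlaw]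
  exact (measurePreserving_eval (fun i => gaussianReal 0 (a i)) i).map_eq

lemma memLp_repr (hT : Measurable T)
    (hlaw : P.map (fun y i => b.repr (T y) i) = Measure.pi fun i => gaussianReal 0 (a i)) (i : ι) :
    MemLp (fun y => b.repr (T y) i) 2 P := by
  have h := memLp_id_gaussianReal (μ := 0) (v := a i) 2
  rw [← map_repr_eq_gaussianReal hT hlaw i] at h
  exact (memLp_map_measure_iff (by fun_prop) (measurable_repr_comp b hT i).aemeasurable).1 h

lemma integral_sq_repr (hT : Measurable T)
    (hlaw : P.map (fun y i => b.repr (T y) i) = Measure.pi fun i => gaussianReal 0 (a i)) (i : ι) :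
    ∫ y, (b.repr (T y) i) ^ 2 ∂P = a i := by
  rw [← integral_map (φ := fun y => b.repr (T y) i) (f := fun u : ℝ => u ^ 2)
    (measurable_repr_comp b hT i).aemeasurable (by fun_prop),
    map_repr_eq_gaussianReal hT hlaw i]
  have h := lintegral_sub_sq_gaussianReal 0 (a i)
  rw [integral_eq_lintegral_of_nonneg_ae (ae_of_all _ fun _ => sq_nonneg _) (by fun_prop)]
  simp only [sub_zero] at h
  simp [h]

lemma lintegral_enorm_sq (hT : Measurable T)
    (hlaw : P.map (fun y i => b.repr (T y) i) = Measure.pi fun i => gaussianReal 0 (a i)) :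
    ∫⁻ y, ‖T y‖ₑ ^ 2 ∂P = ∑ i, (a i : ℝ≥0∞) := by
  have h (y : Ω) : ‖T y‖ₑ ^ 2 = ∑ i, ENNReal.ofReal ((b.repr (T y) i) ^ 2) := by
    simpa using enorm_sub_sq b (T y) 0
  simp_rw [h]
  rw [lintegral_finsetSum _ fun i _ =>
    ((measurable_repr_comp b hT i).pow_const 2).ennreal_ofReal]
  refine Finset.sum_congr rfl fun i _ => ?_
  rw [← ofReal_integral_eq_lintegral_ofReal (memLp_repr hT hlaw i).integrable_sq
    (ae_of_all _ fun _ => sq_nonneg _), integral_sq_repr hT hlaw]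
  simp

/-- The converse: the mutual information constraint bounds the distortion from below. -/
lemma le_lintegral_of_klDiv_le [DecidableEq ι] [IsProbabilityMeasure P] (hT : Measurable T)
    (hlaw : P.map (fun y i => b.repr (T y) i) = Measure.pi fun i => gaussianReal 0 (a i))
    (hθ : θ ≠ 0) (hS : ∀ i ∈ S, θ < a i) (hS' : ∀ i ∉ S, a i ≤ θ)
    (hr : ∑ i ∈ S, 1 / 2 * Real.log (a i / θ) = r)
    (μ : Measure (Ω × E)) [IsProbabilityMeasure μ] (hμ : μ.fst = P)
    (hkl : InformationTheory.klDiv μ (P.prod μ.snd) ≤ r) :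
    ∑ i, ((if i ∈ S then θ else a i : NNReal) : ℝ≥0∞) ≤ ∫⁻ p, ‖T p.1 - p.2‖ₑ ^ 2 ∂μ := by
  have hθ' : (0 : ℝ) < θ := by positivity
  let u : ι → Ω × E → ℝ := fun i p => b.repr (T p.1) i
  let x : ι → Ω × E → ℝ := fun i p => b.repr p.2 i
  have hu (i) : Measurable (u i) := (measurable_repr_comp b hT i).comp measurable_fst
  have hx (i) : Measurable (x i) := (measurable_repr b i).comp measurable_snd
  have hm (i) : Measurable fun p => (u i p - x i p) ^ 2 := ((hu i).sub (hx i)).pow_const 2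
  have hD : ∫⁻ p, ‖T p.1 - p.2‖ₑ ^ 2 ∂μ = ∑ i, ∫⁻ p, ENNReal.ofReal ((u i p - x i p) ^ 2) ∂μ := by
    simp_rw [enorm_sub_sq b]
    exact lintegral_finsetSum _ fun i _ => ENNReal.measurable_ofReal.comp (hm i)
  rw [hD]
  -- Infinite distortion satisfies the bound trivially; otherwise every squared error is integrable.
  by_cases hfin : ∑ i, ∫⁻ p, ENNReal.ofReal ((u i p - x i p) ^ 2) ∂μ = ∞
  · simp [hfin]
  have hint (i) : Integrable (fun p => (u i p - x i p) ^ 2) μ := by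
    rw [← lintegral_ofReal_ne_top_iff_integrable (hm i).aestronglyMeasurable
      (ae_of_all _ fun _ => sq_nonneg _)]
    exact fun h => hfin (ENNReal.sum_eq_top.2 ⟨i, Finset.mem_univ _, h⟩)
  have hpres : MeasurePreserving Prod.fst μ P := ⟨measurable_fst, hμ⟩
  have hui (i) : Integrable (fun p => (u i p) ^ 2) μ :=
    hpres.integrable_comp_of_integrable (memLp_repr hT hlaw i).integrable_sq
  have hua (i) : ∫ p, (u i p) ^ 2 ∂μ = a i := by
    rw [← integral_sq_repr hT hlaw i, ← hμ, Measure.fst, integral_map measurable_fst.aemeasurable]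
    exact ((measurable_repr_comp b hT i).pow_const 2).aestronglyMeasurable
  -- This is max(aᵢ, θ): coordinates outside S contribute no logarithm to the rate.
  let m : ι → NNReal := fun i => if i ∈ S then a i else θ
  have hm0 (i) : 0 < m i := by
    by_cases hi : i ∈ S
    · simpa [m, hi] using hθ.bot_lt.trans (hS i hi)
    · simpa [m, hi] using hθ.bot_lt
  let F : Ω × E → ℝ := fun p => ∑ i, tilt (m i) θ (u i p) (x i p)
  have htm (i) : Measurable fun p => tilt (m i) θ (u i p) (x i p) :=
    (measurable_tilt (m i) θ).comp ((hu i).prodMk (hx i))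
  have hFm : Measurable F := Finset.measurable_sum _ fun i _ => htm i
  have hti (i) : Integrable (fun p => tilt (m i) θ (u i p) (x i p)) μ :=
    (integrable_tilt_and_integral_eq (hui i) (hint i) _ _).1
  have hFint : Integrable F μ := integrable_finsetSum _ fun i _ => hti i
  have hFexp : ∫⁻ p, ENNReal.ofReal (Real.exp (F p)) ∂(P.prod μ.snd) ≤ 1 := by
    -- The reproduction has an arbitrary law, so the source is integrated first and the bound holds
    -- for each fixed reproduction.
    rw [lintegral_prod_symm' _ (by fun_prop)]
    calc _ ≤ ∫⁻ _, 1 ∂μ.snd := lintegral_mono fun z => ?_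
      _ = 1 := by simp
    simp only [F, ofReal_exp_sum, u, x]
    have hf (i) : Measurable fun w => ENNReal.ofReal (Real.exp (tilt (m i) θ w (b.repr z i))) := by
      unfold tilt; fun_prop
    rw [lintegral_prod_repr hT hlaw hf]
    refine Finset.prod_le_one' fun i _ => ?_
    by_cases hi : i ∈ S
    · have h := congrArg (fun ν => ν Set.univ) (withDensity_tilt_source
        (hθ.bot_lt.trans (hS i hi)).ne' hθ (b.repr z i))
      simp only [withDensity_apply _ MeasurableSet.univ, Measure.restrict_univ,
        measure_univ] at h
      simp [m, hi, h]
    · simpa [m, hi] using lintegral_tilt_le_one hθ (hS' i hi) _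
  have hkey := integral_le_toReal_klDiv hFint hFm hFexp (hkl.trans_lt ENNReal.coe_lt_top).ne
  have hkl' : (InformationTheory.klDiv μ (P.prod μ.snd)).toReal ≤ r :=
    ENNReal.toReal_le_of_le_ofReal r.2 (by simpa using hkl)
  have hFval : ∫ p, F p ∂μ = ∑ i, (1 / 2 * Real.log (m i / θ) + a i / (2 * m i)
      - (∫ p, (u i p - x i p) ^ 2 ∂μ) / (2 * θ)) := by
    simp only [F]
    rw [integral_finsetSum _ fun i _ => hti i]
    refine Finset.sum_congr rfl fun i _ => ?_
    rw [(integrable_tilt_and_integral_eq (hui i) (hint i) _ _).2, hua]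
  have hlog : ∑ i, 1 / 2 * Real.log (m i / θ) = r := by
    rw [← hr, ← Finset.sum_subset (Finset.subset_univ S)]
    · exact Finset.sum_congr rfl fun i hi => by simp [m, hi]
    · intro i _ hi
      simp [m, hi, hθ'.ne']
  -- On S both terms equal 1/2, elsewhere both equal aᵢ/(2θ). The mean of F is therefore r plus
  -- (claimed distortion - actual distortion)/(2θ), and it is at most r.
  have hrat : ∑ i, (a i : ℝ) / (2 * m i) = (∑ i, ((if i ∈ S then θ else a i : NNReal) : ℝ)) /
      (2 * θ) := by
    rw [Finset.sum_div]
    refine Finset.sum_congr rfl fun i _ => ?_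
    by_cases hi : i ∈ S
    · have : (0 : ℝ) < a i := by exact_mod_cast hθ.bot_lt.trans (hS i hi)
      simp only [m, hi, if_true]
      field_simp
    · simp [m, hi]
  rw [hFval, Finset.sum_sub_distrib, Finset.sum_add_distrib, hlog, hrat, ← Finset.sum_div] at hkey
  have hfinal : (∑ i, ((if i ∈ S then θ else a i : NNReal) : ℝ)) ≤
      ∑ i, ∫ p, (u i p - x i p) ^ 2 ∂μ := by
    have h1 := (hkey.trans hkl')
    rw [add_sub_assoc, add_le_iff_nonpos_right, sub_nonpos] at h1
    exact (div_le_div_iff_of_pos_right (by positivity)).1 h1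
  have h2 (i) : ∫⁻ p, ENNReal.ofReal ((u i p - x i p) ^ 2) ∂μ =
      ENNReal.ofReal (∫ p, (u i p - x i p) ^ 2 ∂μ) :=
    (ofReal_integral_eq_lintegral_ofReal (hint i) (ae_of_all _ fun _ => sq_nonneg _)).symm
  simp_rw [h2]
  rw [← ENNReal.ofReal_sum_of_nonneg fun i _ => integral_nonneg fun _ => sq_nonneg _]
  refine le_trans (le_of_eq ?_) (ENNReal.ofReal_le_ofReal hfinal)
  rw [← NNReal.coe_sum, ENNReal.ofReal_coe_nnreal, ENNReal.ofNNReal_finsetSum]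

/-- The law of the reproduction of the test channel. -/
noncomputable def reproductionLaw (b : OrthonormalBasis ι ℝ E) (a : ι → NNReal) (θ : NNReal) :
    Measure E :=
  (Measure.pi fun i => gaussianReal 0 (a i - θ)).map fun v => b.repr.symm (WithLp.toLp 2 v)

lemma measurable_symm_toLp (b : OrthonormalBasis ι ℝ E) :
    Measurable fun v : ι → ℝ => b.repr.symm (WithLp.toLp 2 v) := by
  have : Continuous fun v : ι → ℝ => b.repr.symm (WithLp.toLp 2 v) := by fun_prop
  exact this.measurable

instance : IsProbabilityMeasure (reproductionLaw b a θ) :=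
  Measure.isProbabilityMeasure_map (measurable_symm_toLp b).aemeasurable

/-- The redundant `id` gives the law the shape required by the lemmas on a source T, here applied
with T = `id`. -/
lemma map_repr_reproductionLaw :
    (reproductionLaw b a θ).map (fun x i => b.repr (id x) i) =
      Measure.pi fun i => gaussianReal 0 (a i - θ) := by
  rw [reproductionLaw, Measure.map_map
    (measurable_pi_lambda _ fun i => measurable_repr_comp b measurable_id i)
    (measurable_symm_toLp b)]
  convert! Measure.map_id
  ext v i
  simp

lemma measurable_channelDensity (hT : Measurable T) :
    Measurable (fun p : Ω × E => channelDensity b T a θ S p.1 p.2) :=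
  Finset.measurable_sum _ fun i _ => (measurable_tilt (a i) θ).comp
    (((measurable_repr_comp b hT i).comp measurable_fst).prodMk
      ((measurable_repr b i).comp measurable_snd))

variable [DecidableEq ι]

/-- Normalisation in the reproduction variable: this makes the test channel a Markov kernel. -/
lemma lintegral_channelDensity_reproduction {Ω : Type*} {T : Ω → E} (hθ : θ ≠ 0) (hS : ∀ i ∈ S, θ < a i) (y : Ω) :
    ∫⁻ x, ENNReal.ofReal (Real.exp (channelDensity b T a θ S y x)) ∂(reproductionLaw b a θ)
      = 1 := by
  simp_rw [ofReal_exp_channelDensity]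
  refine (lintegral_prod_repr (T := id) measurable_id map_repr_reproductionLaw
    fun i => measurable_ite_tilt_right (S := S) (a := a) (θ := θ) i (b.repr (T y) i)).trans ?_
  refine Finset.prod_eq_one fun i _ => ?_
  split_ifs with hi
  · have h := congrArg (fun ν => ν Set.univ)
      (withDensity_tilt_reproduction hθ (hS i hi) (b.repr (T y) i))
    simpa only [withDensity_apply _ MeasurableSet.univ, Measure.restrict_univ,
      measure_univ] using h
  · simp

/-- Normalisation in the source variable: this identifies the law of the output as
`reproductionLaw`. -/
lemma lintegral_channelDensity_source (hT : Measurable T)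
    (hlaw : P.map (fun y i => b.repr (T y) i) = Measure.pi fun i => gaussianReal 0 (a i))
    (hθ : θ ≠ 0) (hS : ∀ i ∈ S, θ < a i) (x : E) :
    ∫⁻ y, ENNReal.ofReal (Real.exp (channelDensity b T a θ S y x)) ∂P = 1 := by
  simp_rw [ofReal_exp_channelDensity]
  rw [lintegral_prod_repr hT hlaw fun i => measurable_ite_tilt_left i _]
  exact Finset.prod_eq_one fun i _ => lintegral_tilt_source hθ hS i _

/-- The mean square error of the test channel in one coordinate. -/
lemma lintegral_sub_sq_mul_channelDensity [IsProbabilityMeasure P] (hT : Measurable T)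
    (hlaw : P.map (fun y i => b.repr (T y) i) = Measure.pi fun i => gaussianReal 0 (a i))
    (hθ : θ ≠ 0) (hS : ∀ i ∈ S, θ < a i) (hS' : ∀ i ∉ S, a i ≤ θ) (i : ι) :
    ∫⁻ p, ENNReal.ofReal ((b.repr (T p.1) i - b.repr p.2 i) ^ 2) ∂((P.prod
      (reproductionLaw b a θ)).withDensity
        fun p => ENNReal.ofReal (Real.exp (channelDensity b T a θ S p.1 p.2))) =
      ((if i ∈ S then θ else a i : NNReal) : ℝ≥0∞) := by
  have hGm := (measurable_channelDensity (b := b) (a := a) (θ := θ) (S := S) hT).exp.ennreal_ofReal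
  have hdm : Measurable fun p : Ω × E =>
      ENNReal.ofReal ((b.repr (T p.1) i - b.repr p.2 i) ^ 2) :=
    ((((measurable_repr_comp b hT i).comp measurable_fst).sub
      ((measurable_repr b i).comp measurable_snd)).pow_const 2).ennreal_ofReal
  rw [lintegral_withDensity_eq_lintegral_mul _ hGm hdm, lintegral_prod_symm' _ (hGm.mul hdm)]
  -- Here aᵢ - θ truncates to 0 in `NNReal`, so the reproduced coordinate has a degenerate law at 0.
  have hzero : i ∉ S → ∀ᵐ x ∂(reproductionLaw b a θ), b.repr x i = 0 := by
    intro hi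
    have h := map_repr_eq_gaussianReal (T := id) measurable_id
      (map_repr_reproductionLaw (b := b) (a := a) (θ := θ)) i
    rw [tsub_eq_zero_of_le (hS' i hi), gaussianReal_zero_var] at h
    refine ae_of_ae_map (p := fun z : ℝ => z = 0) (measurable_repr b i).aemeasurable ?_
    simp only [id] at h
    rw [h]
    simp
  have hinner : ∀ᵐ x ∂(reproductionLaw b a θ),
      ∫⁻ y, ENNReal.ofReal (Real.exp (channelDensity b T a θ S y x)) *
        ENNReal.ofReal ((b.repr (T y) i - b.repr x i) ^ 2) ∂P =
          ((if i ∈ S then θ else a i : NNReal) : ℝ≥0∞) := by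
    have hz : ∀ᵐ x ∂(reproductionLaw b a θ), i ∉ S → b.repr x i = 0 := by
      by_cases hi : i ∈ S
      · simp [hi]
      · simpa [hi] using hzero hi
    filter_upwards [hz] with x hx
    let f : ι → ℝ → ℝ≥0∞ := fun j w =>
      if j ∈ S then ENNReal.ofReal (Real.exp (tilt (a j) θ w (b.repr x j))) else 1
    -- The squared error is absorbed into the i-th factor, so that the integrand remains a product
    -- over coordinates; the other factors integrate to one.
    let g : ι → ℝ → ℝ≥0∞ := Function.update f i
      fun w => f i w * ENNReal.ofReal ((w - b.repr x i) ^ 2)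
    have hfm (j) : Measurable (f j) := measurable_ite_tilt_left j _
    have hgm (j) : Measurable (g j) := by
      by_cases hj : j = i
      · subst hj
        simp only [g, Function.update_self]
        exact (hfm j).mul (by fun_prop)
      · simpa [g, hj] using hfm j
    have hprod (y : Ω) : ENNReal.ofReal (Real.exp (channelDensity b T a θ S y x)) *
        ENNReal.ofReal ((b.repr (T y) i - b.repr x i) ^ 2) = ∏ j, g j (b.repr (T y) j) := by
      rw [ofReal_exp_channelDensity, ← Finset.mul_prod_erase _ _ (Finset.mem_univ i),
        ← Finset.mul_prod_erase _ (fun j => g j _) (Finset.mem_univ i), mul_right_comm]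
      congr 1
      · simp [g, f]
      · refine Finset.prod_congr rfl fun j hj => ?_
        simp [g, f, Finset.ne_of_mem_erase hj]
    simp_rw [hprod]
    rw [lintegral_prod_repr hT hlaw hgm, Finset.prod_eq_single i]
    · simp only [g, Function.update_self, f]
      by_cases hi : i ∈ S
      · simp only [hi, if_true]
        rw [← lintegral_sub_sq_gaussianReal (b.repr x i) θ, ← withDensity_tilt_source
          (hθ.bot_lt.trans (hS i hi)).ne' hθ (b.repr x i), lintegral_withDensity_eq_lintegral_mul _
          (by unfold tilt; fun_prop) (by fun_prop)]
        rfl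
      · simp only [hi, if_false, one_mul, hx hi]
        exact lintegral_sub_sq_gaussianReal 0 (a i)
    · intro j _ hj
      simp only [g, Function.update_of_ne hj]
      exact lintegral_tilt_source hθ hS j _
    · simp
  refine (lintegral_congr_ae hinner).trans ?_
  simp

/-- Reverse water-filling for a source with independent Gaussian coordinates. -/
theorem exists_channel [IsProbabilityMeasure P] (hT : Measurable T)
    (hlaw : P.map (fun y i => b.repr (T y) i) = Measure.pi fun i => gaussianReal 0 (a i))
    (hθ : θ ≠ 0) (hS : ∀ i ∈ S, θ < a i) (hS' : ∀ i ∉ S, a i ≤ θ)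
    (hr : ∑ i ∈ S, 1 / 2 * Real.log (a i / θ) = r) :
    ∃ κ : Kernel Ω E, IsMarkovKernel κ ∧
      InformationTheory.klDiv (P ⊗ₘ κ) ((P ⊗ₘ κ).fst.prod (P ⊗ₘ κ).snd) ≤ r ∧
      ∫⁻ p, ‖T p.1 - p.2‖ₑ ^ 2 ∂(P ⊗ₘ κ) =
        ∑ i, ((if i ∈ S then θ else a i : NNReal) : ℝ≥0∞) := by
  let Q := reproductionLaw b a θ
  let G : Ω × E → ℝ := fun p => channelDensity b T a θ S p.1 p.2
  have hGm : Measurable G := measurable_channelDensity hT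
  have hGe : Measurable fun p => ENNReal.ofReal (Real.exp (G p)) := hGm.exp.ennreal_ofReal
  let κ : Kernel Ω E := (Kernel.const Ω Q).withDensity
    fun y x => ENNReal.ofReal (Real.exp (channelDensity b T a θ S y x))
  have hκm : IsMarkovKernel κ := ⟨fun y => ⟨by
    rw [Kernel.withDensity_apply' _ hGe]
    simpa using lintegral_channelDensity_reproduction hθ hS y⟩⟩
  have hμ : P ⊗ₘ κ = (P.prod Q).withDensity fun p => ENNReal.ofReal (Real.exp (G p)) := by
    rw [Measure.compProd_withDensity hGe, Measure.compProd_const]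
  have hsnd : (P ⊗ₘ κ).snd = Q := by
    ext s hs
    have hs' : MeasurableSet (Prod.snd ⁻¹' s : Set (Ω × E)) := measurable_snd hs
    rw [Measure.snd_apply hs, hμ, withDensity_apply _ hs', ← lintegral_indicator hs',
      lintegral_prod_symm' _ (hGe.indicator hs')]
    have h (x : E) : ∫⁻ y, (Prod.snd ⁻¹' s).indicator
        (fun p => ENNReal.ofReal (Real.exp (G p))) (y, x) ∂P = s.indicator 1 x := by
      by_cases hx : x ∈ s
      · simpa [Set.indicator, hx] using lintegral_channelDensity_source hT hlaw hθ hS x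
      · simp [Set.indicator, hx]
    simp_rw [h]
    exact lintegral_indicator_one hs
  have hcoord (i) : ∫⁻ p, ENNReal.ofReal ((b.repr (T p.1) i - b.repr p.2 i) ^ 2) ∂(P ⊗ₘ κ) =
      ((if i ∈ S then θ else a i : NNReal) : ℝ≥0∞) := by
    rw [hμ]
    exact lintegral_sub_sq_mul_channelDensity hT hlaw hθ hS hS' i
  have hdm (i) : Measurable fun p : Ω × E => (b.repr (T p.1) i - b.repr p.2 i) ^ 2 :=
    (((measurable_repr_comp b hT i).comp measurable_fst).sub
      ((measurable_repr b i).comp measurable_snd)).pow_const 2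
  refine ⟨κ, hκm, ?_, ?_⟩
  · rw [Measure.fst_compProd, hsnd]
    have hac : P ⊗ₘ κ ≪ P.prod Q := hμ ▸ withDensity_absolutelyContinuous _ _
    -- The divergence is thus the mean of G under the joint law.
    have hllr : llr (P ⊗ₘ κ) (P.prod Q) =ᵐ[P ⊗ₘ κ] G := by
      refine hac.ae_le ?_
      have h := Measure.rnDeriv_withDensity (P.prod Q) hGe
      rw [← hμ] at h
      filter_upwards [h] with p hp
      simp [llr, hp, (Real.exp_pos _).le]
    have hdi (i) : Integrable (fun p : Ω × E => (b.repr (T p.1) i - b.repr p.2 i) ^ 2)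
        (P ⊗ₘ κ) := by
      rw [← lintegral_ofReal_ne_top_iff_integrable (hdm i).aestronglyMeasurable
        (ae_of_all _ fun _ => sq_nonneg _), hcoord]
      simp
    have hdv (i) (hi : i ∈ S) :
        ∫ p, (b.repr (T p.1) i - b.repr p.2 i) ^ 2 ∂(P ⊗ₘ κ) = θ := by
      rw [integral_eq_lintegral_of_nonneg_ae (ae_of_all _ fun _ => sq_nonneg _)
        (hdm i).aestronglyMeasurable, hcoord]
      simp [hi]
    have hpres : MeasurePreserving Prod.fst (P ⊗ₘ κ) P := ⟨measurable_fst, Measure.fst_compProd _ _⟩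
    have hui (i) : Integrable (fun p : Ω × E => (b.repr (T p.1) i) ^ 2) (P ⊗ₘ κ) :=
      hpres.integrable_comp_of_integrable (memLp_repr hT hlaw i).integrable_sq
    have hua (i) : ∫ p, (b.repr (T p.1) i) ^ 2 ∂(P ⊗ₘ κ) = a i := by
      rw [← integral_sq_repr hT hlaw i]
      conv_rhs => rw [← hpres.map_eq]
      rw [integral_map measurable_fst.aemeasurable]
      rw [hpres.map_eq]
      exact ((measurable_repr_comp b hT i).pow_const 2).aestronglyMeasurable
    have hGi : Integrable G (P ⊗ₘ κ) := integrable_finsetSum _ fun i _ =>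
      (integrable_tilt_and_integral_eq (hui i) (hdi i) _ _).1
    have hGv : ∫ p, G p ∂(P ⊗ₘ κ) = r := by
      simp only [G, channelDensity]
      rw [integral_finsetSum _ fun i _ => (integrable_tilt_and_integral_eq (hui i) (hdi i) _ _).1,
        ← hr]
      refine Finset.sum_congr rfl fun i hi => ?_
      rw [(integrable_tilt_and_integral_eq (hui i) (hdi i) _ _).2, hua, hdv i hi]
      have h1 : (0 : ℝ) < θ := by positivity
      have h2 : (0 : ℝ) < a i := by exact_mod_cast hθ.bot_lt.trans (hS i hi)
      -- The quadratic terms a/(2a) and θ/(2θ) cancel, leaving the logarithm.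
      field_simp
      ring
    rw [InformationTheory.klDiv_of_ac_of_integrable hac ((integrable_congr hllr).2 hGi),
      integral_congr_ae hllr, hGv]
    simp
  · simp_rw [enorm_sub_sq b]
    rw [lintegral_finsetSum _ fun i _ => (hdm i).ennreal_ofReal]
    exact Finset.sum_congr rfl fun i _ => hcoord i

end Coordinates


/-! ### The linear Gaussian model: conditional mean and splitting of the distortion -/

section Model

variable {M L : ℕ}

local notation "𝔼" n => EuclideanSpace ℝ (Fin n)

/-- The continuous linear map given by a matrix. -/
noncomputable def matCLM {m n : ℕ} (B : Matrix (Fin m) (Fin n) ℝ) : (𝔼 n) →L[ℝ] (𝔼 m) :=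
  LinearMap.toContinuousLinearMap (Matrix.toEuclideanLin B)

lemma matCLM_apply {m n : ℕ} (B : Matrix (Fin m) (Fin n) ℝ) (x : 𝔼 n) :
    matCLM B x = Matrix.toEuclideanLin B x := rfl

lemma matCLM_mul {m n o : ℕ} (B : Matrix (Fin m) (Fin n) ℝ) (C : Matrix (Fin n) (Fin o) ℝ)
    (x : 𝔼 o) : matCLM (B * C) x = matCLM B (matCLM C x) := by
  ext i
  simp [matCLM_apply, Matrix.mulVec_mulVec]

lemma matCLM_add {m n : ℕ} (B C : Matrix (Fin m) (Fin n) ℝ) (x : 𝔼 n) :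
    matCLM (B + C) x = matCLM B x + matCLM C x := by
  ext i
  simp [matCLM_apply]

lemma matCLM_smul_one {n : ℕ} (c : ℝ) (x : 𝔼 n) :
    matCLM (c • (1 : Matrix (Fin n) (Fin n) ℝ)) x = c • x := by
  ext i
  simp [matCLM_apply]

lemma inner_matCLM {m n : ℕ} (B : Matrix (Fin m) (Fin n) ℝ) (x : 𝔼 m) (y : 𝔼 n) :
    inner ℝ x (matCLM B y) = inner ℝ (matCLM Bᵀ x) y := by
  simp only [matCLM_apply, EuclideanSpace.inner_eq_star_dotProduct,
    Matrix.ofLp_toLpLin, Matrix.toLin'_apply, star_trivial]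
  rw [Matrix.mulVec_transpose, dotProduct_comm, Matrix.dotProduct_mulVec, dotProduct_comm]

/-- The matrix of the linear estimate of `X` from `Y`. -/
noncomputable def estimator (A : Matrix (Fin L) (Fin M) ℝ) (σ : ℝ) : Matrix (Fin M) (Fin L) ℝ :=
  Aᵀ * (A * Aᵀ + σ ^ 2 • (1 : Matrix (Fin L) (Fin L) ℝ))⁻¹

lemma posSemidef_smul_one (n : ℕ) (σ : ℝ) :
    (σ ^ 2 • (1 : Matrix (Fin n) (Fin n) ℝ)).PosSemidef :=
  Matrix.PosSemidef.one.smul (sq_nonneg σ)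

lemma posSemidef_mul_transpose (A : Matrix (Fin L) (Fin M) ℝ) : (A * Aᵀ).PosSemidef := by
  simpa using Matrix.posSemidef_self_mul_conjTranspose A

lemma posDef_obsCov (A : Matrix (Fin L) (Fin M) ℝ) {σ : ℝ} (hσ : 0 < σ) :
    (A * Aᵀ + σ ^ 2 • (1 : Matrix (Fin L) (Fin L) ℝ)).PosDef :=
  Matrix.PosDef.posSemidef_add (posSemidef_mul_transpose A)
    (Matrix.PosDef.one.smul (by positivity))

lemma estimator_mul_obsCov (A : Matrix (Fin L) (Fin M) ℝ) {σ : ℝ} (hσ : 0 < σ) :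
    estimator A σ * (A * Aᵀ + σ ^ 2 • (1 : Matrix (Fin L) (Fin L) ℝ)) = Aᵀ := by
  rw [estimator, Matrix.mul_assoc, Matrix.nonsing_inv_mul _ (posDef_obsCov A hσ).det_pos.ne'.isUnit,
    Matrix.mul_one]

lemma estimator_mul (A : Matrix (Fin L) (Fin M) ℝ) (σ : ℝ) :
    estimator A σ * A = estimateCov A σ := rfl

lemma posSemidef_estimateCov (A : Matrix (Fin L) (Fin M) ℝ) {σ : ℝ} (hσ : 0 < σ) :
    (estimateCov A σ).PosSemidef := by
  simpa [estimateCov] using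
    (posDef_obsCov A hσ).inv.posSemidef.conjTranspose_mul_mul_same A

/-- The covariance BKBᵀ of BY: since BK = Aᵀ, it is (BA)ᵀ, and BA is symmetric. -/
lemma estimator_conj (A : Matrix (Fin L) (Fin M) ℝ) {σ : ℝ} (hσ : 0 < σ) :
    estimator A σ * (A * Aᵀ + σ ^ 2 • (1 : Matrix (Fin L) (Fin L) ℝ)) * (estimator A σ)ᵀ =
      estimateCov A σ := by
  have h : (estimateCov A σ)ᵀ = estimateCov A σ := by
    simpa using (posSemidef_estimateCov A hσ).isHermitian.eq
  rw [estimator_mul_obsCov A hσ, ← Matrix.transpose_mul, estimator_mul, h]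

instance (A : Matrix (Fin L) (Fin M) ℝ) (σ : ℝ) : IsGaussian (modelLaw A σ) := by
  have h : (fun p : (𝔼 M) × (𝔼 L) => (p.1, Matrix.toEuclideanLin A p.1 + p.2)) =
      (ContinuousLinearMap.fst ℝ (𝔼 M) (𝔼 L)).prod
        ((matCLM A).comp (ContinuousLinearMap.fst ℝ _ _) + ContinuousLinearMap.snd ℝ _ _) := rfl
  rw [modelLaw, h]
  infer_instance

instance (A : Matrix (Fin L) (Fin M) ℝ) (σ : ℝ) : IsProbabilityMeasure (modelLaw A σ) :=
  inferInstance

instance (A : Matrix (Fin L) (Fin M) ℝ) (σ : ℝ) : IsProbabilityMeasure (obsLaw A σ) := by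
  unfold obsLaw; infer_instance

lemma measurable_model (A : Matrix (Fin L) (Fin M) ℝ) :
    Measurable (fun p : (𝔼 M) × (𝔼 L) => (p.1, Matrix.toEuclideanLin A p.1 + p.2)) := by
  have h : Measurable (matCLM A) := (matCLM A).continuous.measurable
  exact measurable_fst.prodMk ((h.comp measurable_fst).add measurable_snd)

lemma covariance_inner_gaussian {n : ℕ} {S : Matrix (Fin n) (Fin n) ℝ} (hS : S.PosSemidef)
    (x y : 𝔼 n) :
    cov[fun u => inner ℝ x u, fun u => inner ℝ y u; multivariateGaussian 0 S] =
      inner ℝ x (matCLM S y) := by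
  rw [← covarianceBilin_apply_eq_cov IsGaussian.memLp_two_id,
    covarianceBilin_multivariateGaussian hS, matCLM_apply,
    EuclideanSpace.inner_eq_star_dotProduct, dotProduct_comm]
  simp

/-- The covariance of two linear functionals of independent centred Gaussian vectors. -/
lemma covariance_inner_add_inner {n m : ℕ} {S : Matrix (Fin n) (Fin n) ℝ}
    {S' : Matrix (Fin m) (Fin m) ℝ} (hS : S.PosSemidef) (hS' : S'.PosSemidef)
    (a c : 𝔼 n) (b d : 𝔼 m) :
    cov[fun p => inner ℝ a p.1 + inner ℝ b p.2, fun p => inner ℝ c p.1 + inner ℝ d p.2;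
      (multivariateGaussian 0 S).prod (multivariateGaussian 0 S')] =
      inner ℝ a (matCLM S c) + inner ℝ b (matCLM S' d) := by
  set μ := multivariateGaussian (0 : 𝔼 n) S
  set ν := multivariateGaussian (0 : 𝔼 m) S'
  have h1 (x : 𝔼 n) : MemLp (fun p : (𝔼 n) × (𝔼 m) => inner ℝ x p.1) 2 (μ.prod ν) :=
    (((IsGaussian.hasGaussianLaw_id (μ := μ.prod ν)).map_fun
      ((innerSL ℝ x).comp (ContinuousLinearMap.fst ℝ _ _)))).memLp_two
  have h2 (x : 𝔼 m) : MemLp (fun p : (𝔼 n) × (𝔼 m) => inner ℝ x p.2) 2 (μ.prod ν) :=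
    (((IsGaussian.hasGaussianLaw_id (μ := μ.prod ν)).map_fun
      ((innerSL ℝ x).comp (ContinuousLinearMap.snd ℝ _ _)))).memLp_two
  have hind (x : 𝔼 n) (y : 𝔼 m) : cov[fun p : (𝔼 n) × (𝔼 m) => inner ℝ x p.1,
      fun p => inner ℝ y p.2; μ.prod ν] = 0 :=
    (indepFun_prod (μ := μ) (ν := ν) (X := fun u => inner ℝ x u) (Y := fun u => inner ℝ y u)
      (by fun_prop) (by fun_prop)).covariance_eq_zero (h1 x) (h2 y)
  have e1 : cov[fun p : (𝔼 n) × (𝔼 m) => inner ℝ a p.1, fun p => inner ℝ c p.1; μ.prod ν] =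
      inner ℝ a (matCLM S c) := by
    rw [← covariance_inner_gaussian hS a c]
    change _ = cov[_, _; μ]
    have hm : μ = (μ.prod ν).map Prod.fst := measurePreserving_fst.map_eq.symm
    refine Eq.trans ?_ (congrArg (fun ρ => cov[_, _; ρ]) hm).symm
    rw [covariance_map_fun (by fun_prop) (by fun_prop) (by fun_prop)]
  have e2 : cov[fun p : (𝔼 n) × (𝔼 m) => inner ℝ b p.2, fun p => inner ℝ d p.2; μ.prod ν] =
      inner ℝ b (matCLM S' d) := by
    rw [← covariance_inner_gaussian hS' b d]
    change _ = cov[_, _; ν]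
    have hm : ν = (μ.prod ν).map Prod.snd := measurePreserving_snd.map_eq.symm
    refine Eq.trans ?_ (congrArg (fun ρ => cov[_, _; ρ]) hm).symm
    rw [covariance_map_fun (by fun_prop) (by fun_prop) (by fun_prop)]
  change cov[(fun p : (𝔼 n) × (𝔼 m) => inner ℝ a p.1) + (fun p => inner ℝ b p.2),
    (fun p : (𝔼 n) × (𝔼 m) => inner ℝ c p.1) + (fun p => inner ℝ d p.2); μ.prod ν] = _
  have hind' : cov[fun p : (𝔼 n) × (𝔼 m) => inner ℝ b p.2, fun p => inner ℝ c p.1; μ.prod ν] = 0 :=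
    (covariance_comm _ _).trans (hind c b)
  rw [covariance_add_left (h1 a) (h2 b) ((h1 c).add (h2 d)),
    covariance_add_right (h1 a) (h1 c) (h2 d), covariance_add_right (h2 b) (h1 c) (h2 d),
    hind, hind', e1, e2]
  ring

/-- Moving A across the inner product, ⟨a, X⟩ + ⟨b, AX + Z⟩ = ⟨a + Aᵀb, X⟩ + ⟨b, Z⟩, with X and Z
independent. -/
lemma covariance_modelLaw (A : Matrix (Fin L) (Fin M) ℝ) (σ : ℝ) (a c : 𝔼 M) (b d : 𝔼 L) :
    cov[fun p => inner ℝ a p.1 + inner ℝ b p.2, fun p => inner ℝ c p.1 + inner ℝ d p.2;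
      modelLaw A σ] =
      inner ℝ (a + matCLM Aᵀ b) (c + matCLM Aᵀ d) + σ ^ 2 * inner ℝ b d := by
  have h := covariance_inner_add_inner Matrix.PosSemidef.one (posSemidef_smul_one L σ)
    (a + matCLM Aᵀ b) (c + matCLM Aᵀ d) b d
  have h1 (x : 𝔼 M) : matCLM 1 x = x := by
    simpa using matCLM_smul_one 1 x
  rw [h1, matCLM_smul_one, inner_smul_right] at h
  rw [← h, modelLaw, covariance_map_fun (by fun_prop) (by fun_prop)
    (measurable_model A).aemeasurable]
  congr 1 <;> ext p <;> rw [inner_add_left, ← inner_matCLM, matCLM_apply, inner_add_right] <;> ring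

lemma covariance_obsLaw (A : Matrix (Fin L) (Fin M) ℝ) (σ : ℝ) (b d : 𝔼 L) :
    cov[fun y => inner ℝ b y, fun y => inner ℝ d y; obsLaw A σ] =
      inner ℝ b (matCLM (A * Aᵀ + σ ^ 2 • (1 : Matrix (Fin L) (Fin L) ℝ)) d) := by
  rw [obsLaw, Measure.snd, covariance_map_fun (by fun_prop) (by fun_prop) (by fun_prop)]
  have h := covariance_modelLaw A σ 0 0 b d
  simp only [inner_zero_left, zero_add] at h
  rw [h, matCLM_add, matCLM_smul_one, inner_add_right, inner_smul_right, matCLM_mul, inner_matCLM A]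

/-- The estimation error is independent of the observation. -/
lemma indepFun_error (A : Matrix (Fin L) (Fin M) ℝ) {σ : ℝ} (hσ : 0 < σ) :
    IndepFun (fun p : (𝔼 M) × (𝔼 L) => p.1 - matCLM (estimator A σ) p.2) Prod.snd
      (modelLaw A σ) := by
  refine HasGaussianLaw.indepFun_of_covariance_inner
    ((IsGaussian.hasGaussianLaw_id (μ := modelLaw A σ)).map_fun
      ((ContinuousLinearMap.fst ℝ (𝔼 M) (𝔼 L) - (matCLM (estimator A σ)).comp
        (ContinuousLinearMap.snd ℝ _ _)).prod (ContinuousLinearMap.snd ℝ _ _))) fun x y => ?_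
  have h := covariance_modelLaw A σ x 0 (-matCLM (estimator A σ)ᵀ x) y
  simp only [inner_sub_right, inner_matCLM, inner_zero_left, zero_add, inner_neg_left] at h ⊢
  simp only [← sub_eq_add_neg] at h
  rw [h]
  -- The normal equations BK = Aᵀ are what makes the covariance vanish.
  have e := congrArg (fun B => inner ℝ x (matCLM B y)) (estimator_mul_obsCov A hσ)
  simp only [Matrix.mul_add, matCLM_add, matCLM_mul, inner_add_right, matCLM_smul_one, map_smul,
    inner_smul_right] at e
  rw [map_neg, map_add, map_neg, inner_add_left, inner_neg_left, ← inner_matCLM Aᵀ, ← e]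
  simp only [inner_matCLM, Matrix.transpose_transpose]
  ring

/-- The law of the estimation error. -/
noncomputable def errorLaw (A : Matrix (Fin L) (Fin M) ℝ) (σ : ℝ) : Measure (𝔼 M) :=
  (modelLaw A σ).map fun p => p.1 - matCLM (estimator A σ) p.2

lemma measurable_error (A : Matrix (Fin L) (Fin M) ℝ) (σ : ℝ) :
    Measurable fun p : (𝔼 M) × (𝔼 L) => p.1 - matCLM (estimator A σ) p.2 := by
  fun_prop

instance (A : Matrix (Fin L) (Fin M) ℝ) (σ : ℝ) : IsGaussian (errorLaw A σ) := by
  have h : (fun p : (𝔼 M) × (𝔼 L) => p.1 - matCLM (estimator A σ) p.2) =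
      (ContinuousLinearMap.fst ℝ (𝔼 M) (𝔼 L) -
        (matCLM (estimator A σ)).comp (ContinuousLinearMap.snd ℝ (𝔼 M) (𝔼 L))) := rfl
  rw [errorLaw, h, ← FunLike.coe_sub]
  infer_instance

/-- Independence recast as a change of variables: X is rebuilt as error plus BY, so the error can be
integrated out separately. -/
lemma modelLaw_eq_map (A : Matrix (Fin L) (Fin M) ℝ) {σ : ℝ} (hσ : 0 < σ) :
    modelLaw A σ = ((errorLaw A σ).prod (obsLaw A σ)).map
      fun q => (q.1 + matCLM (estimator A σ) q.2, q.2) := by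
  have h := (indepFun_iff_map_prod_eq_prod_map_map (measurable_error A σ).aemeasurable
    measurable_snd.aemeasurable).1 (indepFun_error A hσ)
  have h' : (errorLaw A σ).prod (obsLaw A σ) = (modelLaw A σ).map
      fun p => (p.1 - matCLM (estimator A σ) p.2, p.2) := h.symm
  rw [h', Measure.map_map (by fun_prop) (by fun_prop)]
  convert! Measure.map_id.symm
  ext p : 1
  simp

lemma integral_fst_modelLaw (A : Matrix (Fin L) (Fin M) ℝ) (σ : ℝ) :
    ∫ p, p.1 ∂(modelLaw A σ) = 0 := by
  rw [modelLaw, integral_map (measurable_model A).aemeasurable (by fun_prop),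
    integral_fun_fst (fun x => x)]
  simp

lemma integral_snd_modelLaw (A : Matrix (Fin L) (Fin M) ℝ) (σ : ℝ) :
    ∫ p, p.2 ∂(modelLaw A σ) = 0 := by
  rw [modelLaw, integral_map (measurable_model A).aemeasurable (by fun_prop)]
  simp only
  have h0 : Integrable (fun p : (𝔼 M) × (𝔼 L) => p)
      ((multivariateGaussian 0 1).prod (multivariateGaussian 0 (σ ^ 2 • 1))) :=
    IsGaussian.integrable_fun_id
  have h1 := (matCLM A).integrable_comp h0.fst
  have h2 := h0.snd
  simp only [matCLM_apply] at h1
  rw [integral_add h1 h2, integral_fun_snd (fun x => x),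
    integral_fun_fst (fun x => Matrix.toEuclideanLin A x)]
  have h3 := (matCLM A).integral_comp_comm
    (IsGaussian.integrable_fun_id (μ := multivariateGaussian (0 : 𝔼 M) 1))
  simp only [matCLM_apply] at h3
  rw [h3]
  simp

lemma integrable_fst_modelLaw (A : Matrix (Fin L) (Fin M) ℝ) (σ : ℝ) :
    Integrable (fun p => p.1) (modelLaw A σ) :=
  (IsGaussian.integrable_fun_id (μ := modelLaw A σ)).fst

lemma integrable_snd_modelLaw (A : Matrix (Fin L) (Fin M) ℝ) (σ : ℝ) :
    Integrable (fun p => p.2) (modelLaw A σ) :=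
  (IsGaussian.integrable_fun_id (μ := modelLaw A σ)).snd

lemma integrable_estimate (A : Matrix (Fin L) (Fin M) ℝ) (σ : ℝ) :
    Integrable (fun p => matCLM (estimator A σ) p.2) (modelLaw A σ) :=
  (matCLM (estimator A σ)).integrable_comp (integrable_snd_modelLaw A σ)

lemma integral_error (A : Matrix (Fin L) (Fin M) ℝ) (σ : ℝ) :
    ∫ p, (p.1 - matCLM (estimator A σ) p.2) ∂(modelLaw A σ) = 0 := by
  rw [integral_sub (integrable_fst_modelLaw A σ) (integrable_estimate A σ),
    ContinuousLinearMap.integral_comp_comm _ (integrable_snd_modelLaw A σ), integral_fst_modelLaw,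
    integral_snd_modelLaw]
  simp

/-- The conditional expectation is the linear estimate. -/
lemma condMean_ae_eq (A : Matrix (Fin L) (Fin M) ℝ) {σ : ℝ} (hσ : 0 < σ) :
    condMean A σ =ᵐ[modelLaw A σ] fun p => matCLM (estimator A σ) p.2 := by
  have hle : MeasurableSpace.comap (Prod.snd : (𝔼 M) × (𝔼 L) → 𝔼 L) inferInstance ≤
      (inferInstance : MeasurableSpace ((𝔼 M) × (𝔼 L))) := measurable_snd.comap_le
  have hsm : StronglyMeasurable[MeasurableSpace.comap (Prod.snd : (𝔼 M) × (𝔼 L) → 𝔼 L)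
      inferInstance] fun p : (𝔼 M) × (𝔼 L) => matCLM (estimator A σ) p.2 :=
    ((matCLM (estimator A σ)).continuous.measurable.comp
      (comap_measurable Prod.snd)).stronglyMeasurable
  -- X = (X - BY) + BY: the second term is a function of Y, the first is independent of Y with mean
  -- zero.
  have h1 := condExp_add (m := MeasurableSpace.comap Prod.snd inferInstance)
    ((integrable_fst_modelLaw A σ).sub (integrable_estimate A σ)) (integrable_estimate A σ)
  rw [sub_add_cancel, condExp_of_stronglyMeasurable hle hsm (integrable_estimate A σ)] at h1
  have h2 := condExp_indep_eq (measurable_error A σ).comap_le hle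
    (comap_measurable (fun p : (𝔼 M) × (𝔼 L) =>
      p.1 - matCLM (estimator A σ) p.2)).stronglyMeasurable (indepFun_error A hσ)
  rw [integral_error] at h2
  refine h1.trans ?_
  filter_upwards [h2] with p hp
  rw [Pi.add_apply]
  exact (congrArg (· + _) hp).trans (zero_add _)

lemma mmse_eq (A : Matrix (Fin L) (Fin M) ℝ) {σ : ℝ} (hσ : 0 < σ) :
    mmse A σ = ∫⁻ u, ‖u‖ₑ ^ 2 ∂(errorLaw A σ) := by
  rw [errorLaw, lintegral_map (by fun_prop) (measurable_error A σ), mmse]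
  refine lintegral_congr_ae ?_
  filter_upwards [condMean_ae_eq A hσ] with p hp
  rw [hp]

lemma estimateDistortion_eq (A : Matrix (Fin L) (Fin M) ℝ) {σ : ℝ} (hσ : 0 < σ)
    (κ : Kernel (𝔼 L) (𝔼 M)) [IsMarkovKernel κ] :
    estimateDistortion A σ κ =
      ∫⁻ p, ‖matCLM (estimator A σ) p.1 - p.2‖ₑ ^ 2 ∂(obsLaw A σ ⊗ₘ κ) := by
  have h : ∀ᵐ p ∂(jointLaw A σ κ), condMean A σ p.1 = matCLM (estimator A σ) p.1.2 := by
    have hp : MeasurePreserving Prod.fst (jointLaw A σ κ) (modelLaw A σ) :=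
      ⟨measurable_fst, Measure.fst_compProd _ _⟩
    exact hp.quasiMeasurePreserving.ae (condMean_ae_eq A hσ)
  rw [estimateDistortion, lintegral_congr_ae (h.mono fun p hp => by
    rw [hp]), jointLaw,
    Measure.lintegral_compProd (by fun_prop), Measure.lintegral_compProd (by fun_prop), obsLaw,
    Measure.snd, lintegral_map _ measurable_snd]
  · simp
  · exact Measurable.lintegral_kernel_prod_right' (κ := κ)
      (f := fun p => ‖matCLM (estimator A σ) p.1 - p.2‖ₑ ^ 2) (by fun_prop)

/-- The cross term 2⟨u, v⟩ integrates to zero because the mean is zero. -/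
lemma lintegral_enorm_add_sq {E : Type*} [NormedAddCommGroup E] [InnerProductSpace ℝ E]
    [CompleteSpace E] [SecondCountableTopology E] [MeasurableSpace E] [BorelSpace E]
    {μ : Measure E} [IsProbabilityMeasure μ] (hμ : MemLp id 2 μ) (h0 : ∫ u, u ∂μ = 0) (v : E) :
    ∫⁻ u, ‖u + v‖ₑ ^ 2 ∂μ = ∫⁻ u, ‖u‖ₑ ^ 2 ∂μ + ‖v‖ₑ ^ 2 := by
  have hi : Integrable (fun u : E => u) μ := hμ.integrable one_le_two
  have hsq : Integrable (fun u : E => ‖u‖ ^ 2) μ := hμ.integrable_norm_pow two_ne_zero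
  have hin : Integrable (fun u : E => inner ℝ u v) μ := hi.inner_const v
  have hiv : ∫ u, inner ℝ u v ∂μ = 0 := by
    simp_rw [real_inner_comm v]
    rw [integral_inner hi, h0, inner_zero_right]
  have hsum : Integrable (fun u : E => ‖u‖ ^ 2 + 2 * inner ℝ u v + ‖v‖ ^ 2) μ :=
    (hsq.add (hin.const_mul 2)).add (integrable_const _)
  have he (w : E) : ‖w‖ₑ ^ 2 = ENNReal.ofReal (‖w‖ ^ 2) := by
    rw [ENNReal.ofReal_pow (norm_nonneg _), ofReal_norm]
  simp_rw [he, norm_add_sq_real]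
  rw [← ofReal_integral_eq_lintegral_ofReal hsum
      (ae_of_all _ fun u => by simp only [← norm_add_sq_real]; exact sq_nonneg _),
    ← ofReal_integral_eq_lintegral_ofReal hsq (ae_of_all _ fun _ => sq_nonneg _),
    ← ENNReal.ofReal_add (integral_nonneg fun _ => sq_nonneg _) (sq_nonneg _)]
  congr 1
  rw [integral_add (f := fun u : E => ‖u‖ ^ 2 + 2 * inner ℝ u v)
      (hsq.add (hin.const_mul 2)) (integrable_const _),
    integral_add hsq (hin.const_mul 2), integral_const_mul, hiv]
  simp

lemma integral_errorLaw (A : Matrix (Fin L) (Fin M) ℝ) (σ : ℝ) : ∫ u, u ∂(errorLaw A σ) = 0 := by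
  rw [errorLaw, integral_map (measurable_error A σ).aemeasurable (by fun_prop), integral_error]

/-- The distortion splits into the estimation error and the compression error. -/
lemma lintegral_jointLaw (A : Matrix (Fin L) (Fin M) ℝ) {σ : ℝ} (hσ : 0 < σ)
    (κ : Kernel (𝔼 L) (𝔼 M)) [IsMarkovKernel κ] :
    ∫⁻ p, ‖p.1.1 - p.2‖ₑ ^ 2 ∂(jointLaw A σ κ) = mmse A σ + estimateDistortion A σ κ := by
  have hm : Measurable fun p : ((𝔼 M) × (𝔼 L)) × (𝔼 M) => ‖p.1.1 - p.2‖ₑ ^ 2 := by fun_prop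
  rw [jointLaw, Measure.lintegral_compProd hm]
  conv_lhs => rw [modelLaw_eq_map A hσ]
  have hm2 : Measurable fun p : (𝔼 M) × (𝔼 L) =>
      ∫⁻ x, ‖p.1 - x‖ₑ ^ 2 ∂(Kernel.prodMkLeft (𝔼 M) κ p) :=
    Measurable.lintegral_kernel_prod_right' (κ := Kernel.prodMkLeft (𝔼 M) κ) hm
  have hm3 : Measurable fun q : (𝔼 M) × (𝔼 L) =>
      ∫⁻ x, ‖q.1 + matCLM (estimator A σ) q.2 - x‖ₑ ^ 2 ∂(κ q.2) :=
    hm2.comp (f := fun q : (𝔼 M) × (𝔼 L) => (q.1 + matCLM (estimator A σ) q.2, q.2)) (by fun_prop)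
  rw [lintegral_map hm2 (by fun_prop)]
  simp only [Kernel.prodMkLeft_apply]
  rw [lintegral_prod_symm' _ hm3, estimateDistortion_eq A hσ,
    Measure.lintegral_compProd (by fun_prop), mmse_eq A hσ]
  -- For fixed y and x, the centred error u is integrated first, with constant shift By - x.
  have hin (y : 𝔼 L) : ∫⁻ u, ∫⁻ x, ‖u + matCLM (estimator A σ) y - x‖ₑ ^ 2 ∂(κ y) ∂(errorLaw A σ) =
      ∫⁻ u, ‖u‖ₑ ^ 2 ∂(errorLaw A σ) + ∫⁻ x, ‖matCLM (estimator A σ) y - x‖ₑ ^ 2 ∂(κ y) := by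
    rw [lintegral_lintegral_swap (by fun_prop)]
    simp_rw [add_sub_assoc, lintegral_enorm_add_sq (IsGaussian.memLp_two_id (μ := errorLaw A σ))
      (integral_errorLaw A σ)]
    rw [lintegral_add_left measurable_const]
    simp
  simp only [hin]
  rw [lintegral_add_left measurable_const]
  simp

end Model


/-! ### Law of the estimate in an eigenbasis, and the trace identity -/

section Coordinates

variable {M L : ℕ}

local notation "𝔼" n => EuclideanSpace ℝ (Fin n)

instance (A : Matrix (Fin L) (Fin M) ℝ) (σ : ℝ) : IsGaussian (obsLaw A σ) := by
  have h : (Prod.snd : (𝔼 M) × (𝔼 L) → 𝔼 L) = ContinuousLinearMap.snd ℝ (𝔼 M) (𝔼 L) := rfl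
  rw [obsLaw, Measure.snd, h]
  infer_instance

/-- The coordinates of the estimate in an eigenbasis of its covariance matrix are independent. -/
lemma map_repr_estimate (A : Matrix (Fin L) (Fin M) ℝ) {σ : ℝ} (hσ : 0 < σ) :
    (obsLaw A σ).map (fun y i =>
      (posSemidef_estimateCov A hσ).isHermitian.eigenvectorBasis.repr
        (matCLM (estimator A σ) y) i) =
      Measure.pi fun i => gaussianReal 0
        ((posSemidef_estimateCov A hσ).isHermitian.eigenvalues i).toNNReal := by
  set hC := (posSemidef_estimateCov A hσ).isHermitian
  set b := hC.eigenvectorBasis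
  let X : Fin M → (𝔼 L) → ℝ := fun i y => inner ℝ (matCLM (estimator A σ)ᵀ (b i)) y
  have hX (i : Fin M) (y : 𝔼 L) : b.repr (matCLM (estimator A σ) y) i = X i y := by
    rw [b.repr_apply_apply, inner_matCLM]
  simp_rw [hX]
  have hcov (i j : Fin M) : cov[X i, X j; obsLaw A σ] = if i = j then hC.eigenvalues i else 0 := by
    simp only [X]
    rw [covariance_obsLaw, ← inner_matCLM, ← matCLM_mul, ← matCLM_mul, estimator_conj A hσ]
    have h : matCLM (estimateCov A σ) (b j) = hC.eigenvalues j • b j := by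
      ext l
      simpa [matCLM_apply] using congrFun (hC.mulVec_eigenvectorBasis j) l
    rw [h, inner_smul_right, orthonormal_iff_ite.1 b.orthonormal]
    split_ifs with hij
    · simp [hij]
    · simp
  have hG : HasGaussianLaw (fun y i => X i y) (obsLaw A σ) :=
    (IsGaussian.hasGaussianLaw_id (μ := obsLaw A σ)).map_fun
      (ContinuousLinearMap.pi fun i => innerSL ℝ (matCLM (estimator A σ)ᵀ (b i)))
  have hind := hG.iIndepFun_of_covariance_eq_zero fun i j hij => by rw [hcov, if_neg hij]
  rw [(iIndepFun_iff_map_fun_eq_pi_map fun i => (hG.eval i).aemeasurable).1 hind]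
  congr 1
  ext1 i
  rw [(hG.eval i).map_eq_gaussianReal]
  have hmean : ∫ y, X i y ∂(obsLaw A σ) = 0 := by
    simp only [X]
    rw [integral_inner IsGaussian.integrable_fun_id, obsLaw, Measure.snd,
      integral_map measurable_snd.aemeasurable (by fun_prop), integral_snd_modelLaw,
      inner_zero_right]
  have hvar : Var[X i; obsLaw A σ] = hC.eigenvalues i := by
    rw [← covariance_self (hG.eval i).aemeasurable, hcov, if_pos rfl]
  rw [hmean, hvar]

lemma lintegral_enorm_sq_fst_modelLaw (A : Matrix (Fin L) (Fin M) ℝ) (σ : ℝ) :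
    ∫⁻ p, ‖p.1‖ₑ ^ 2 ∂(modelLaw A σ) = M := by
  have hm : (modelLaw A σ).map Prod.fst = multivariateGaussian (0 : 𝔼 M) 1 := by
    rw [modelLaw, Measure.map_map measurable_fst (measurable_model A)]
    exact measurePreserving_fst.map_eq
  have h : ∫⁻ p, ‖p.1‖ₑ ^ 2 ∂(modelLaw A σ) = ∫⁻ x : 𝔼 M, ‖x‖ₑ ^ 2 ∂(multivariateGaussian 0 1) := by
    rw [← hm, lintegral_map (by fun_prop) measurable_fst]
  rw [h]
  refine (lintegral_enorm_sq (T := id) (b := EuclideanSpace.basisFun (Fin M) ℝ) (a := fun _ => 1)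
    measurable_id ?_).trans (by simp)
  rw [multivariateGaussian_zero_one, ← map_pi_eq_stdGaussian, Measure.map_map
    (measurable_pi_lambda _ fun i => measurable_repr_comp _ measurable_id i) (by fun_prop)]
  exact Measure.map_id

/-- The trace identity for the error covariance matrix. -/
lemma mmse_add_sum_eigenvalues (A : Matrix (Fin L) (Fin M) ℝ) {σ : ℝ} (hσ : 0 < σ) :
    mmse A σ + ∑ i, (((posSemidef_estimateCov A hσ).isHermitian.eigenvalues i).toNNReal : ℝ≥0∞)
      = M := by
  -- For the channel that always outputs 0 the splitting reads E‖X‖² = mmse + E‖BY‖², so no error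
  -- covariance has to be computed.
  let κ : Kernel (𝔼 L) (𝔼 M) := Kernel.const _ (Measure.dirac 0)
  have h := lintegral_jointLaw A hσ κ
  rw [estimateDistortion_eq A hσ, jointLaw, Measure.lintegral_compProd (by fun_prop),
    Measure.lintegral_compProd (by fun_prop)] at h
  simp only [Kernel.prodMkLeft_apply, κ, Kernel.const_apply] at h
  have hd (v : 𝔼 M) : ∫⁻ x, ‖v - x‖ₑ ^ 2 ∂(Measure.dirac (0 : 𝔼 M)) = ‖v‖ₑ ^ 2 := by
    rw [lintegral_dirac' _ (by fun_prop), sub_zero]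
  simp only [hd] at h
  rw [lintegral_enorm_sq_fst_modelLaw,
    lintegral_enorm_sq (matCLM (estimator A σ)).continuous.measurable (map_repr_estimate A hσ)] at h
  exact h.symm

end Coordinates


/-! ### Sorted lists of roots -/

section SortedRoots

/-- The `n`-th entry of the decreasing rearrangement of a multiset, and `0` past its end. -/
noncomputable def nthLargest (s : Multiset ℝ) (n : ℕ) : ℝ := (s.sort (· ≥ ·)).getD n 0

/-- Extra zeros sort to the end, where the default value 0 makes them invisible. -/
lemma nthLargest_replicate_zero_add {s : Multiset ℝ} (hs : ∀ x ∈ s, 0 ≤ x) (m n : ℕ) :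
    nthLargest (Multiset.replicate m 0 + s) n = nthLargest s n := by
  have h : (Multiset.replicate m 0 + s).sort (· ≥ ·) =
      s.sort (· ≥ ·) ++ List.replicate m 0 := by
    refine List.Perm.eq_of_pairwise' (Multiset.pairwise_sort _ _) ?_ ?_
    · rw [List.pairwise_append]
      refine ⟨Multiset.pairwise_sort _ _, by simp [List.pairwise_replicate], fun x hx y hy => ?_⟩
      rw [List.eq_of_mem_replicate hy]
      exact hs x (by simpa using hx)
    · rw [← Multiset.coe_eq_coe, ← Multiset.coe_add, Multiset.sort_eq, Multiset.sort_eq, add_comm]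
      rfl
  rw [nthLargest, nthLargest, h]
  rcases lt_or_ge n (s.sort (· ≥ ·)).length with hn | hn
  · rw [List.getD_append _ _ _ _ hn]
  · rw [List.getD_append_right _ _ _ _ hn, List.getD_eq_default _ _ hn]
    simp [List.getD_eq_getElem?_getD, List.getElem?_replicate]
    split_ifs <;> rfl

/-- A monotone map commutes with sorting; `g 0 = 0` covers the default value past the end. -/
lemma nthLargest_map {s : Multiset ℝ} (hs : ∀ x ∈ s, 0 ≤ x) {g : ℝ → ℝ}
    (hg : MonotoneOn g (Set.Ici 0)) (hg0 : g 0 = 0) (n : ℕ) :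
    nthLargest (s.map g) n = g (nthLargest s n) := by
  have h : (s.map g).sort (· ≥ ·) = (s.sort (· ≥ ·)).map g := by
    refine List.Perm.eq_of_pairwise' (Multiset.pairwise_sort _ _) ?_ ?_
    · rw [List.pairwise_map]
      refine (Multiset.pairwise_sort s (· ≥ ·)).imp_of_mem fun {x y} hx hy hxy => ?_
      exact hg (hs y (by simpa using hy)) (hs x (by simpa using hx)) hxy
    · rw [← Multiset.coe_eq_coe, Multiset.sort_eq, ← Multiset.map_coe, Multiset.sort_eq]
  rw [nthLargest, nthLargest, h]
  conv_lhs => rw [← hg0]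
  rw [List.getD_map]

end SortedRoots

/-! ### Ordered eigenvalues, rank and functional calculus -/

section Hermitian

variable {n : ℕ} {C : Matrix (Fin n) (Fin n) ℝ}

/-- The position of an eigenvalue in the decreasing order, counted from `0`. -/
noncomputable def eigIndex (n : ℕ) : Fin n ≃ Fin (Fintype.card (Fin n)) :=
  (Fintype.equivOfCardEq (Fintype.card_fin _)).symm

lemma eigenvalues_eq_eigval (hC : C.IsHermitian) (i : Fin n) :
    hC.eigenvalues i = eigval C ((eigIndex n i : ℕ) + 1) := by
  have h := hC.sort_roots_charpoly_eq_eigenvalues₀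
  have hre : C.charpoly.roots.map (RCLike.re : ℝ → ℝ) = C.charpoly.roots := by simp
  rw [hre] at h
  rw [eigval, h, Nat.add_sub_cancel, List.getD_eq_getElem _ _ (by simpa using (eigIndex n i).2)]
  simp [Matrix.IsHermitian.eigenvalues, eigIndex]

lemma eigval_eq_eigenvalues (hC : C.IsHermitian) {l : ℕ} (hl : l < n) :
    ∃ i, (eigIndex n i : ℕ) = l ∧ eigval C (l + 1) = hC.eigenvalues i := by
  refine ⟨(eigIndex n).symm ⟨l, by simpa using hl⟩, by simp, ?_⟩
  rw [eigenvalues_eq_eigval]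
  simp

lemma eigval_eq_zero_of_le (hC : C.IsHermitian) {l : ℕ} (hl : n ≤ l) : eigval C (l + 1) = 0 := by
  have h := congrArg List.length hC.sort_roots_charpoly_eq_eigenvalues₀
  rw [eigval, List.getD_eq_default]
  simp only [List.length_ofFn, Fintype.card_fin] at h
  simpa using h.le.trans hl

lemma eigenvalues_antitone_eigIndex (hC : C.IsHermitian) {i j : Fin n}
    (h : eigIndex n i ≤ eigIndex n j) : hC.eigenvalues j ≤ hC.eigenvalues i :=
  hC.eigenvalues₀_antitone h

/-- The indices of the `k` largest eigenvalues. -/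
noncomputable def topIndices (n k : ℕ) : Finset (Fin n) :=
  Finset.univ.filter fun i => (eigIndex n i : ℕ) < k

lemma sum_topIndices (hC : C.IsHermitian) {k : ℕ} (hk : k ≤ n) (f : ℝ → ℝ) :
    ∑ i ∈ topIndices n k, f (hC.eigenvalues i) = ∑ l ∈ Finset.Icc 1 k, f (eigval C l) := by
  refine Finset.sum_bij (fun i _ => (eigIndex n i : ℕ) + 1) ?_ ?_ ?_ ?_
  · intro i hi
    simp only [topIndices, Finset.mem_filter_univ] at hi
    simpa using hi
  · intro i _ j _ h
    exact (eigIndex n).injective (Fin.ext (Nat.succ_injective h))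
  · intro l hl
    rw [Finset.mem_Icc] at hl
    refine ⟨(eigIndex n).symm ⟨l - 1, by simp; omega⟩, ?_, ?_⟩
    · simp [topIndices]; omega
    · simp; omega
  · intro i _
    rw [eigenvalues_eq_eigval]

lemma card_topIndices {k : ℕ} (hk : k ≤ n) : (topIndices n k).card = k := by
  have h := sum_topIndices (C := (0 : Matrix (Fin n) (Fin n) ℝ)) Matrix.isHermitian_zero hk
    fun _ => 1
  simpa using h

lemma rank_eq_card_filter (hC : C.IsHermitian) :
    C.rank = (Finset.univ.filter fun i => hC.eigenvalues i ≠ 0).card := by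
  rw [hC.rank_eq_card_non_zero_eigs, Fintype.card_subtype]

/-- If this eigenvalue were zero, all nonzero ones would lie among the first l, forcing the rank to
be at most l. -/
lemma eigval_pos_of_le_rank (hC : C.PosSemidef) {l : ℕ} (hl : l + 1 ≤ C.rank) :
    0 < eigval C (l + 1) := by
  have hn : l < n := by
    have := C.rank_le_width
    omega
  obtain ⟨i, hi, he⟩ := eigval_eq_eigenvalues hC.isHermitian hn
  rw [he]
  refine (hC.eigenvalues_nonneg i).lt_of_ne' fun h0 => ?_
  have hsub : (Finset.univ.filter fun j => hC.isHermitian.eigenvalues j ≠ 0) ⊆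
      topIndices n l := by
    intro j hj
    simp only [topIndices, Finset.mem_filter_univ] at hj ⊢
    by_contra hlt
    refine hj (le_antisymm ?_ (hC.eigenvalues_nonneg j))
    rw [← h0]
    exact eigenvalues_antitone_eigIndex hC.isHermitian (by rw [Fin.le_def]; omega)
  have := Finset.card_le_card hsub
  rw [← rank_eq_card_filter, card_topIndices hn.le] at this
  omega

lemma eigval_eq_zero_of_rank_lt (hC : C.PosSemidef) {l : ℕ} (hl : C.rank < l + 1) :
    eigval C (l + 1) = 0 := by
  rcases le_or_gt n l with hn | hn
  · exact eigval_eq_zero_of_le hC.isHermitian hn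
  obtain ⟨i, hi, he⟩ := eigval_eq_eigenvalues hC.isHermitian hn
  rw [he]
  by_contra h0
  have hpos := (hC.eigenvalues_nonneg i).lt_of_ne' h0
  have hsub : topIndices n (l + 1) ⊆
      Finset.univ.filter fun j => hC.isHermitian.eigenvalues j ≠ 0 := by
    intro j hj
    simp only [topIndices, Finset.mem_filter_univ] at hj ⊢
    exact (hpos.trans_le (eigenvalues_antitone_eigIndex hC.isHermitian
      (by rw [Fin.le_def]; omega))).ne'
  have := Finset.card_le_card hsub
  rw [← rank_eq_card_filter, card_topIndices hn] at this
  omega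

lemma roots_charpoly_nonneg (hC : C.PosSemidef) : ∀ x ∈ C.charpoly.roots, 0 ≤ x := by
  intro x hx
  rw [hC.isHermitian.roots_charpoly_eq_eigenvalues] at hx
  obtain ⟨i, _, rfl⟩ := Multiset.mem_map.1 hx
  exact hC.eigenvalues_nonneg i

/-- The matrix is the functional calculus of x ↦ x/(x + c) at C; the denominator is positive on the
spectrum. -/
lemma roots_charpoly_inv_mul (hC : C.PosSemidef) {c : ℝ} (hc : 0 < c) :
    ((C + c • (1 : Matrix (Fin n) (Fin n) ℝ))⁻¹ * C).charpoly.roots =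
      C.charpoly.roots.map fun x => x / (x + c) := by
  have hsa : IsSelfAdjoint C := hC.isHermitian
  have hcont (f : ℝ → ℝ) : ContinuousOn f (spectrum ℝ C) :=
    (Matrix.finite_real_spectrum (A := C)).continuousOn f
  have hK : C + c • (1 : Matrix (Fin n) (Fin n) ℝ) = cfc (fun x => x + c) C := by
    rw [cfc_add_const c (fun x : ℝ => x) C (hcont _) hsa, cfc_id' ℝ C hsa,
      Algebra.algebraMap_eq_smul_one]
  have hdet : IsUnit (C + c • (1 : Matrix (Fin n) (Fin n) ℝ)).det :=
    (Matrix.PosDef.posSemidef_add hC (Matrix.PosDef.one.smul hc)).det_pos.ne'.isUnit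
  have hmul : (C + c • (1 : Matrix (Fin n) (Fin n) ℝ)) * cfc (fun x => x / (x + c)) C = C := by
    rw [hK, ← cfc_mul _ _ C (hcont _) (hcont _)]
    conv_rhs => rw [← cfc_id' ℝ C hsa]
    refine cfc_congr fun x hx => ?_
    rw [hC.isHermitian.spectrum_real_eq_range_eigenvalues] at hx
    obtain ⟨i, rfl⟩ := hx
    have := hC.eigenvalues_nonneg i
    field_simp
  have h : (C + c • (1 : Matrix (Fin n) (Fin n) ℝ))⁻¹ * C = cfc (fun x => x / (x + c)) C := by
    conv_lhs => rw [← hmul]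
    -- The previous rewrite expanded both copies of C; the one inside the inverse is restored.
    conv_lhs => arg 1; rw [hmul]
    rw [← Matrix.mul_assoc, Matrix.nonsing_inv_mul _ hdet, Matrix.one_mul]
  rw [h, hC.isHermitian.charpoly_cfc_eq, hC.isHermitian.roots_charpoly_eq_eigenvalues,
    Polynomial.roots_prod _ _ (by simp [Finset.prod_ne_zero_iff, Polynomial.X_sub_C_ne_zero])]
  simp [Function.comp_def]

end Hermitian

/-- The eigenvalues of the covariance matrix of the estimate. -/
lemma eigval_estimateCov {M L : ℕ} (A : Matrix (Fin L) (Fin M) ℝ) {σ : ℝ} (hσ : 0 < σ) (l : ℕ) :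
    eigval (estimateCov A σ) l = eigval (A * Aᵀ) l / (eigval (A * Aᵀ) l + σ ^ 2) := by
  have hσ2 : 0 < σ ^ 2 := by positivity
  have hB := posSemidef_mul_transpose A
  -- AᵀK⁻¹A and K⁻¹AAᵀ have the same characteristic polynomial up to powers of the variable, that
  -- is, the same roots up to zeros.
  have h := Matrix.charpoly_mul_comm' Aᵀ
    ((A * Aᵀ + σ ^ 2 • (1 : Matrix (Fin L) (Fin L) ℝ))⁻¹ * A)
  rw [← Matrix.mul_assoc, Matrix.mul_assoc _ A Aᵀ] at h
  have hr := congrArg Polynomial.roots h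
  rw [Polynomial.roots_mul (mul_ne_zero (pow_ne_zero _ Polynomial.X_ne_zero)
      (Matrix.charpoly_monic _).ne_zero),
    Polynomial.roots_mul (mul_ne_zero (pow_ne_zero _ Polynomial.X_ne_zero)
      (Matrix.charpoly_monic _).ne_zero), Polynomial.roots_X_pow, Polynomial.roots_X_pow,
    roots_charpoly_inv_mul hB hσ2, Multiset.nsmul_singleton, Multiset.nsmul_singleton] at hr
  have hn := congrArg (fun s => nthLargest s (l - 1)) hr
  have hg (x : ℝ) (hx : 0 ≤ x) : 0 ≤ x / (x + σ ^ 2) := by positivity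
  have h1 := roots_charpoly_nonneg (posSemidef_estimateCov A hσ)
  rw [estimateCov] at h1
  rw [nthLargest_replicate_zero_add h1, nthLargest_replicate_zero_add, nthLargest_map
    (roots_charpoly_nonneg hB) _ (by simp)] at hn
  · exact hn
  · intro x hx y hy hxy
    have hx' : 0 ≤ x := hx
    have hy' : 0 ≤ y := hy
    rw [div_le_div_iff₀ (by positivity) (by positivity)]
    nlinarith
  · intro y hy
    obtain ⟨x, hx, rfl⟩ := Multiset.mem_map.1 hy
    exact hg x (roots_charpoly_nonneg hB x hx)


/-! ### The water level and the rate thresholds -/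

section WaterLevel

variable {n : ℕ} {C : Matrix (Fin n) (Fin n) ℝ} {k : ℕ} {R : ℝ}

lemma eigval_pos (hC : C.PosSemidef) (hk : k ≤ C.rank) {l : ℕ} (hl : l ∈ Finset.Icc 1 k) :
    0 < eigval C l := by
  rw [Finset.mem_Icc] at hl
  obtain ⟨m, rfl⟩ : ∃ m, l = m + 1 := ⟨l - 1, by omega⟩
  exact eigval_pos_of_le_rank hC (hl.2.trans hk)

lemma waterLevel_pos (hC : C.PosSemidef) (hk : k ≤ C.rank) : 0 < waterLevel C k R :=
  mul_pos (by positivity)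
    (Real.rpow_pos_of_pos (Finset.prod_pos fun _ hl => eigval_pos hC hk hl) _)

/-- In logarithms the definition of θ is linear, which reduces the threshold comparisons to linear
arithmetic. -/
lemma mul_log_waterLevel (hC : C.PosSemidef) (hk1 : 1 ≤ k) (hk : k ≤ C.rank) :
    k * Real.log (waterLevel C k R) =
      ∑ l ∈ Finset.Icc 1 k, Real.log (eigval C l) - 2 * (R * Real.log 2) := by
  have hp : 0 < ∏ l ∈ Finset.Icc 1 k, eigval C l :=
    Finset.prod_pos fun _ hl => eigval_pos hC hk hl
  have hk0 : (k : ℝ) ≠ 0 := by positivity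
  rw [waterLevel, Real.log_mul (by positivity) (Real.rpow_pos_of_pos hp _).ne',
    Real.log_rpow (by norm_num), Real.log_rpow hp,
    Real.log_prod fun l hl => (eigval_pos hC hk hl).ne']
  field_simp
  ring

lemma sum_logb_div (hC : C.PosSemidef) {m : ℕ} (hk : m ≤ C.rank) {x : ℝ} (hx : 0 < x) :
    (1 / 2 : ℝ) * ∑ l ∈ Finset.Icc 1 m, Real.logb 2 (eigval C l / x) =
      (∑ l ∈ Finset.Icc 1 m, Real.log (eigval C l) - m * Real.log x) / (2 * Real.log 2) := by
  have h : ∑ l ∈ Finset.Icc 1 m, Real.logb 2 (eigval C l / x) =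
      (∑ l ∈ Finset.Icc 1 m, Real.log (eigval C l) - m * Real.log x) / Real.log 2 := by
    rw [sub_div, Finset.sum_div]
    have h2 : (m : ℝ) * Real.log x / Real.log 2 =
        ∑ _l ∈ Finset.Icc 1 m, Real.log x / Real.log 2 := by
      simp [mul_div_assoc]
    rw [h2, ← Finset.sum_sub_distrib]
    refine Finset.sum_congr rfl fun l hl => ?_
    rw [Real.logb, Real.log_div (eigval_pos hC hk hl).ne' hx.ne', sub_div]
  rw [h]
  field_simp

lemma waterLevel_lt_eigval (hC : C.PosSemidef) (hk1 : 1 ≤ k) (hk : k ≤ C.rank)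
    (hR : rateThreshold C k < (R : EReal)) : waterLevel C k R < eigval C k := by
  have hpos := eigval_pos hC hk (Finset.mem_Icc.2 ⟨hk1, le_rfl⟩)
  have hlt : (1 / 2 : ℝ) * ∑ l ∈ Finset.Icc 1 k, Real.logb 2 (eigval C l / eigval C k) < R := by
    rw [rateThreshold] at hR
    split_ifs at hR with h1
    · subst h1
      -- For k = 1 the general formula also gives 0, as its only term is log 1.
      simpa [hpos.ne'] using hR
    · exact_mod_cast hR
  rw [sum_logb_div hC hk hpos, div_lt_iff₀ (by positivity)] at hlt
  rw [← Real.log_lt_log_iff (waterLevel_pos hC hk) hpos]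
  have h := mul_log_waterLevel (R := R) hC hk1 hk
  have hk0 : (0 : ℝ) < k := by positivity
  nlinarith

lemma eigval_succ_le_waterLevel (hC : C.PosSemidef) (hk1 : 1 ≤ k) (hk : k ≤ C.rank)
    (hR : (R : EReal) ≤ rateThreshold C (k + 1)) : eigval C (k + 1) ≤ waterLevel C k R := by
  rcases lt_or_ge C.rank (k + 1) with hlt | hle
  -- At k = rank the threshold is infinite and the next eigenvalue is 0.
  · rw [eigval_eq_zero_of_rank_lt hC hlt]
    exact (waterLevel_pos hC hk).le
  have hpos := eigval_pos_of_le_rank hC hle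
  rw [rateThreshold, if_neg (by omega), if_pos hle, EReal.coe_le_coe_iff,
    sum_logb_div hC hle hpos, le_div_iff₀ (by positivity),
    Finset.sum_Icc_succ_top (by omega)] at hR
  rw [← Real.log_le_log_iff hpos (waterLevel_pos hC hk)]
  have h := mul_log_waterLevel (R := R) hC hk1 hk
  have hk0 : (0 : ℝ) < k := by positivity
  push_cast at hR
  -- The top term of the sum cancels one of the k + 1 copies of log λₖ₊₁, leaving k.
  have h3 : (k : ℝ) * Real.log (eigval C (k + 1)) ≤ k * Real.log (waterLevel C k R) := by
    linarith
  exact le_of_mul_le_mul_left h3 hk0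

lemma sum_log_div_waterLevel (hC : C.PosSemidef) (hk1 : 1 ≤ k) (hk : k ≤ C.rank) :
    ∑ l ∈ Finset.Icc 1 k, 1 / 2 * Real.log (eigval C l / waterLevel C k R) =
      R * Real.log 2 := by
  have h (l) (hl : l ∈ Finset.Icc 1 k) : 1 / 2 * Real.log (eigval C l / waterLevel C k R) =
      1 / 2 * (Real.log (eigval C l) - Real.log (waterLevel C k R)) := by
    rw [Real.log_div (eigval_pos hC hk hl).ne' (waterLevel_pos hC hk).ne']
  rw [Finset.sum_congr rfl h, ← Finset.mul_sum, Finset.sum_sub_distrib]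
  simp only [Finset.sum_const, Nat.card_Icc, Nat.add_sub_cancel, nsmul_eq_mul]
  rw [mul_log_waterLevel hC hk1 hk]
  ring

end WaterLevel

/-! ### Optimal channels and the value of the distortion -/

section RateDistortion

variable {M L : ℕ} {A : Matrix (Fin L) (Fin M) ℝ} {σ R : ℝ} {k : ℕ}

/-- Conversion from bits to nats. -/
lemma mutualInfo_le_iff {α β : Type*} [MeasurableSpace α] [MeasurableSpace β]
    {μ : Measure (α × β)} {r : NNReal} (hr : (r : ℝ) = R * Real.log 2) :
    mutualInfo μ ≤ ENNReal.ofReal R ↔ InformationTheory.klDiv μ (μ.fst.prod μ.snd) ≤ r := by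
  have h2 : 0 < Real.log 2 := Real.log_pos one_lt_two
  rw [mutualInfo, ENNReal.div_le_iff (by simpa using h2) ENNReal.ofReal_ne_top,
    ← ENNReal.ofReal_mul' h2.le, ← hr, ENNReal.ofReal_coe_nnreal]

/-- The distortion-rate function of the estimate, by reverse water-filling. -/
lemma isLeast_estimateDistortion (hσ : 0 < σ) (hk1 : 1 ≤ k) (hk : k ≤ (estimateCov A σ).rank)
    (hR : rateThreshold (estimateCov A σ) k < (R : EReal))
    (hR' : (R : EReal) ≤ rateThreshold (estimateCov A σ) (k + 1)) :
    IsLeast (estimateDistortion A σ '' feasible A σ R)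
      (∑ i, ((if i ∈ topIndices M k then (waterLevel (estimateCov A σ) k R).toNNReal else
        ((posSemidef_estimateCov A hσ).isHermitian.eigenvalues i).toNNReal : NNReal) : ℝ≥0∞)) := by
  have hC := posSemidef_estimateCov A hσ
  set C := estimateCov A σ
  have hkM : k ≤ M := hk.trans C.rank_le_width
  have hw := waterLevel_pos (R := R) hC hk
  have hlt := waterLevel_lt_eigval hC hk1 hk hR
  have hle := eigval_succ_le_waterLevel hC hk1 hk hR'
  set θ := waterLevel C k R
  have hS (i) (hi : i ∈ topIndices M k) : θ.toNNReal < (hC.isHermitian.eigenvalues i).toNNReal := by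
    rw [Real.toNNReal_lt_toNNReal_iff_of_nonneg hw.le]
    refine hlt.trans_le ?_
    obtain ⟨j, hj, he⟩ := eigval_eq_eigenvalues hC.isHermitian (l := k - 1) (by omega)
    rw [Nat.sub_add_cancel hk1] at he
    rw [he]
    simp only [topIndices, Finset.mem_filter_univ] at hi
    exact eigenvalues_antitone_eigIndex hC.isHermitian (by rw [Fin.le_def]; omega)
  have hS' (i) (hi : i ∉ topIndices M k) :
      (hC.isHermitian.eigenvalues i).toNNReal ≤ θ.toNNReal := by
    refine Real.toNNReal_le_toNNReal (le_trans ?_ hle)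
    simp only [topIndices, Finset.mem_filter_univ, not_lt] at hi
    have hkM' : k < M := by
      have := (eigIndex M i).2
      simp only [Fintype.card_fin] at this
      omega
    obtain ⟨j, hj, he⟩ := eigval_eq_eigenvalues hC.isHermitian hkM'
    rw [he]
    exact eigenvalues_antitone_eigIndex hC.isHermitian (by rw [Fin.le_def]; omega)
  have hsum : ∑ i ∈ topIndices M k, 1 / 2 * Real.log
      ((hC.isHermitian.eigenvalues i).toNNReal / θ.toNNReal) = R * Real.log 2 := by
    simp only [Real.coe_toNNReal _ (hC.eigenvalues_nonneg _), Real.coe_toNNReal _ hw.le]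
    rw [sum_topIndices hC.isHermitian hkM fun x => 1 / 2 * Real.log (x / θ)]
    exact sum_log_div_waterLevel hC hk1 hk
  -- The sign of R is not assumed: it follows from the eigenvalues above the water level.
  have hr0 : 0 ≤ R * Real.log 2 := by
    rw [← hsum]
    refine Finset.sum_nonneg fun i hi => mul_nonneg (by norm_num) (Real.log_nonneg ?_)
    have hpos : (0 : ℝ) < θ.toNNReal := by simpa using hw
    rw [one_le_div hpos]
    exact_mod_cast (hS i hi).le
  let r : NNReal := ⟨R * Real.log 2, hr0⟩
  have hθ0 : θ.toNNReal ≠ 0 := by simpa using hw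
  have hT : Measurable (matCLM (estimator A σ)) := (matCLM (estimator A σ)).continuous.measurable
  constructor
  · obtain ⟨κ, hκ, hkl, hd⟩ := exists_channel (r := r) hT (map_repr_estimate A hσ) hθ0 hS hS' hsum
    refine ⟨κ, ⟨hκ, (mutualInfo_le_iff (r := r) rfl).2 hkl⟩, ?_⟩
    rw [estimateDistortion_eq A hσ, hd]
  · rintro _ ⟨κ, ⟨hκ, hI⟩, rfl⟩
    rw [estimateDistortion_eq A hσ]
    rw [mutualInfo_le_iff (r := r) rfl, Measure.fst_compProd] at hI
    exact le_lintegral_of_klDiv_le (r := r) hT (map_repr_estimate A hσ) hθ0 hS hS' hsum _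
      (Measure.fst_compProd _ _) hI

/-- On feasible channels the distortion is a nondecreasing affine function of the compression error,
so a minimiser of the latter also minimises the former. -/
lemma isLeast_distortion (hσ : 0 < σ) {D₀ : ℝ≥0∞}
    (h : IsLeast (estimateDistortion A σ '' feasible A σ R) D₀) :
    IsLeast (distortion A σ '' feasible A σ R) ((mmse A σ + D₀) / (M : ℝ≥0∞)) := by
  have hd (κ) (hκ : κ ∈ feasible A σ R) :
      distortion A σ κ = (mmse A σ + estimateDistortion A σ κ) / (M : ℝ≥0∞) := by
    have := hκ.1
    rw [distortion, lintegral_jointLaw A hσ]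
  obtain ⟨⟨κ, hκ, rfl⟩, hlow⟩ := h
  refine ⟨⟨κ, hκ, hd κ hκ⟩, ?_⟩
  rintro _ ⟨η, hη, rfl⟩
  rw [hd η hη]
  gcongr
  exact hlow ⟨η, hη, rfl⟩

lemma mmse_ne_top (A : Matrix (Fin L) (Fin M) ℝ) (hσ : 0 < σ) : mmse A σ ≠ ∞ := by
  intro h
  have hm := mmse_add_sum_eigenvalues A hσ
  rw [h, top_add] at hm
  exact ENNReal.natCast_ne_top M hm.symm

/-- The trace identity trades the mmse for M minus all eigenvalues; those outside the top k cancel.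
-/
lemma mmse_add_sum_eq (hσ : 0 < σ) (hk : k ≤ (estimateCov A σ).rank) :
    (mmse A σ + ∑ i, ((if i ∈ topIndices M k then (waterLevel (estimateCov A σ) k R).toNNReal else
        ((posSemidef_estimateCov A hσ).isHermitian.eigenvalues i).toNNReal : NNReal) : ℝ≥0∞)).toReal
      = M - ∑ l ∈ Finset.Icc 1 k, eigval (estimateCov A σ) l
        + k * waterLevel (estimateCov A σ) k R := by
  have hC := posSemidef_estimateCov A hσ
  have hm := mmse_add_sum_eigenvalues A hσ
  have hw := waterLevel_pos (R := R) hC hk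
  have hkM : k ≤ M := hk.trans (Matrix.rank_le_width _)
  set C := estimateCov A σ
  set θ := waterLevel C k R
  have hfin := mmse_ne_top A hσ
  have hmr := congrArg ENNReal.toReal hm
  rw [ENNReal.toReal_add hfin (by simp), ENNReal.toReal_sum (by simp)] at hmr
  rw [ENNReal.toReal_add hfin (by simp), ENNReal.toReal_sum (by simp)]
  simp only [ENNReal.coe_toReal, Real.coe_toNNReal _ (hC.eigenvalues_nonneg _),
    ENNReal.toReal_natCast, apply_ite NNReal.toReal, Real.coe_toNNReal _ hw.le] at hmr ⊢
  have h1 (i : Fin M) : (if i ∈ topIndices M k then θ else hC.isHermitian.eigenvalues i) =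
      hC.isHermitian.eigenvalues i +
        if i ∈ topIndices M k then θ - hC.isHermitian.eigenvalues i else 0 := by
    split_ifs <;> ring
  rw [Finset.sum_congr rfl fun i _ => h1 i, Finset.sum_add_distrib, ← add_assoc, hmr,
    Finset.sum_ite_mem, Finset.univ_inter, sum_topIndices hC.isHermitian hkM fun x => θ - x,
    Finset.sum_sub_distrib]
  simp
  ring

end RateDistortion

end RemoteSource

theorem proposition1 {M L : ℕ} (A : Matrix (Fin L) (Fin M) ℝ) (hA : A.rank = min M L)
    (σ : ℝ) (hσ : 0 < σ) (R : ℝ) (k : ℕ) (hk : k ∈ Finset.Icc 1 (min M L))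
    (hR : RemoteSource.rateThreshold (RemoteSource.estimateCov A σ) k < (R : EReal))
    (hR' : (R : EReal) ≤ RemoteSource.rateThreshold (RemoteSource.estimateCov A σ) (k + 1))
    (D : ℝ)
    (hD : D = 1
      - 1 / (M : ℝ) * ∑ l ∈ Finset.Icc 1 k,
          RemoteSource.eigval (A * Aᵀ) l / (RemoteSource.eigval (A * Aᵀ) l + σ ^ 2)
      + (k : ℝ) / (M : ℝ) * RemoteSource.waterLevel (RemoteSource.estimateCov A σ) k R) :
    0 ≤ D ∧ RemoteSource.iDRF A σ R = ENNReal.ofReal D ∧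
      ∃ D₀ : ℝ≥0∞,
        IsLeast (RemoteSource.estimateDistortion A σ '' RemoteSource.feasible A σ R) D₀ ∧
        (RemoteSource.mmse A σ + D₀) / (M : ℝ≥0∞) = ENNReal.ofReal D := by
  rw [Finset.mem_Icc] at hk
  -- Full rank of A makes λₖ(AAᵀ) positive, hence also λₖ/(λₖ + σ²), so the covariance has rank at
  -- least k.
  have hrank : k ≤ (RemoteSource.estimateCov A σ).rank := by
    by_contra hlt
    obtain ⟨l, rfl⟩ : ∃ l, k = l + 1 := ⟨k - 1, by omega⟩
    have h0 := RemoteSource.eigval_eq_zero_of_rank_lt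
      (RemoteSource.posSemidef_estimateCov A hσ) (not_le.1 hlt)
    have hpos := RemoteSource.eigval_pos_of_le_rank (RemoteSource.posSemidef_mul_transpose A)
      (l := l) (by rw [Matrix.rank_self_mul_transpose, hA]; exact hk.2)
    rw [RemoteSource.eigval_estimateCov A hσ] at h0
    exact absurd h0 (by positivity)
  have hM : (0 : ℝ) < M := by
    have : 0 < M := by omega
    exact_mod_cast this
  have hleast := RemoteSource.isLeast_estimateDistortion hσ hk.1 hrank hR hR'
  have hval := RemoteSource.mmse_add_sum_eq (R := R) hσ hrank
  have hDx : D = (M - ∑ l ∈ Finset.Icc 1 k, RemoteSource.eigval (RemoteSource.estimateCov A σ) l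
      + k * RemoteSource.waterLevel (RemoteSource.estimateCov A σ) k R) / M := by
    rw [hD]
    simp only [RemoteSource.eigval_estimateCov A hσ]
    field_simp
  rw [← hval] at hDx
  have hDval := congrArg ENNReal.ofReal hDx
  rw [ENNReal.ofReal_div_of_pos hM, ENNReal.ofReal_natCast, ENNReal.ofReal_toReal
    (ENNReal.add_ne_top.2 ⟨RemoteSource.mmse_ne_top A hσ, by simp⟩)] at hDval
  refine ⟨hDx ▸ by positivity, ?_, _, hleast, hDval.symm⟩
  rw [hDval]
  exact (RemoteSource.isLeast_distortion hσ hleast).csInf_eq
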